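/- **Small-Entropy Theorem.** All logarithms are to base $2$ and $\mathcal X=\mathbb Z/q\mathbb Z$ with $q\ge 1$. *Plant.* Consider $X_{t+1}=AX_t+BU_t+V_t$, $t\in\mathbb N$, with $X_t,V_t\in\mathbb R^{n_x}$, $U_t\in\mathbb R^{n_u}$ and real matrices $A,B$. Here $(A,B)$ is stabilizable (some $K$ makes all eigenvalues of $A+BK$ have modulus $<1$) and $A$ has at least one eigenvalue of modulus greater than one. Let $h_{lin}=\sum_{|\lambda_i|\ge 1}\log|\lambda_i|$, the sum being over the eigenvalues of $A$ with multiplicity. *Channel.* The channel is a finite-state additive noise channel $Y_t=Q_t\oplus Z_t$ over $\mathcal X$. The noise $Z_t$ is the label of the $t$-th edge of a walk on a finite strongly connected directed graph (without parallel edges) in which every vertex has an outgoing edge, edges carry labels in $\mathcal X$, and distinct edges leaving the same vertex have distinct labels. The initial vertex is arbitrary and unknown, and all label sequences of infinite walks are possible noise sequences. Let $h_{ch}$ be the topological entropy of the noise process, i.e. the exponential growth rate of the number of walks with $n$ edges. Let $C_{0f}$ be the zero-error feedback capacity of the channel: the supremum of $\frac1n\log M$ over all codes with $M\ge 1$ messages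 and blocklength $n\ge1$, whose $i$-th input is a function of the message and of the $i-1$ previous outputs of the block, such that for every starting time no two distinct messages can produce the same block of $n$ outputs. *Loop.* A coder-controller is a pair of sequences of functions $Q_t=\mu_t(X_{1:t})\in\mathcal X$, $U_t=\eta_t(Y_{1:t})\in\mathbb R^{n_u}$. The uncertainties satisfy: $\|X_1\|\le D_x$ and $\|V_t\|\le D$ for all $t$; $X_1$, the plant noise sequence and the channel noise sequence are mutually unrelated (their joint range is the product of their ranges); and $V_t=0$ for all $t$ is a possible plant noise sequence. The state is uniformly bounded if $\sup\|X_t\|<\infty$, the supremum being over all times and all realizations of the uncertainties. Then: 1. If $C_{0f}>0$ and $h_{lin}+h_{ch}<\log q$, there is a coder-controller (which may depend on $A$, $B$, the channel, $D_x$ and $D$) that keeps the state uniformly bounded for all such uncertainties. 2. If $h_{lin}+h_{ch}>\log q$ and the range of the initial state contains a ball of positive radius centred at the origin, then no coder-controller keeps the state uniformly bounded. -/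

import Mathlib

open scoped Matrix

noncomputable section

/-! Time is indexed by `ℕ` starting at `0`: index `t` stands for the time instant `t + 1`.
An uncertain variable is a function on a sample space `Ω`; its range is `Set.range`. -/

/-! ### The linear plant -/

/-- The complex eigenvalues of a real square matrix, with algebraic multiplicity. -/
def complexEigenvalues {n : ℕ} (A : Matrix (Fin n) (Fin n) ℝ) : Multiset ℂ :=
  (A.map (algebraMap ℝ ℂ)).charpoly.roots

/-- The topological entropy of the linear system with dynamical matrix `A` (in bits):
the sum of `log₂ |λ|` over the eigenvalues with `|λ| ≥ 1`, counted with multiplicity. -/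
def linearEntropy {n : ℕ} (A : Matrix (Fin n) (Fin n) ℝ) : ℝ :=
  (((complexEigenvalues A).filter (fun μ => 1 ≤ ‖μ‖)).map (fun μ => Real.logb 2 ‖μ‖)).sum

/-- The pair `(A, B)` is stabilizable: some linear state feedback makes the closed loop
Schur stable. -/
def IsStabilizable {n m : ℕ} (A : Matrix (Fin n) (Fin n) ℝ) (B : Matrix (Fin n) (Fin m) ℝ) :
    Prop :=
  ∃ K : Matrix (Fin m) (Fin n) ℝ, ∀ μ ∈ complexEigenvalues (A + B * K), ‖μ‖ < 1

/-! ### Finite-state additive noise channels -/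

/-- A finite-state machine generating the noise of a `q`-ary finite-state additive noise channel:
a strongly connected directed graph on the set of states `σ` in which every state has an outgoing
edge, each edge carries a value in `ZMod q`, and distinct edges out of the same state carry
distinct values. (`label s t` is meaningful only if there is an edge from `s` to `t`.) -/
structure NoiseMachine (q : ℕ) (σ : Type*) where
  Edge : σ → σ → Prop
  label : σ → σ → ZMod q
  exists_edge : ∀ s, ∃ t, Edge s t
  label_injective : ∀ s t t', Edge s t → Edge s t' → label s t = label s t' → t = t'
  stronglyConnected : ∀ s t, Relation.ReflTransGen Edge s t

namespace NoiseMachine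

variable {q : ℕ} {σ : Type*} (N : NoiseMachine q σ)

/-- The possible noise sequences: the label sequences of the infinite walks, starting from an
arbitrary (unknown) initial state. -/
def noiseSequences : Set (ℕ → ZMod q) :=
  {z | ∃ s : ℕ → σ, (∀ i, N.Edge (s i) (s (i + 1))) ∧ ∀ i, z i = N.label (s i) (s (i + 1))}

/-- The possible state sequences with `n` transitions. -/
def stateSequences (n : ℕ) : Set (Fin (n + 1) → σ) :=
  {s | ∀ i : Fin n, N.Edge (s i.castSucc) (s i.succ)}

/-- The topological entropy of the noise process (in bits): the asymptotic growth rate of the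
number of possible state sequences. -/
def entropy : ℝ :=
  Filter.limsup (fun n : ℕ => Real.logb 2 ((N.stateSequences n).ncard : ℝ) / (n : ℝ)) Filter.atTop

/-- The possible output sequences of the channel `Y = X ⊕ Z` in the time window
`t₀ + 1, …, t₀ + n`, when message `m` is sent with the feedback encoding functions `f`:
the `i`-th input of the window is a function of the message and of the previous outputs of the
window. -/
def codeOutputs {M n : ℕ} (f : (i : Fin n) → Fin M → (Fin i → ZMod q) → ZMod q)
    (t₀ : ℕ) (m : Fin M) : Set (Fin n → ZMod q) :=
  {y | ∃ z ∈ N.noiseSequences,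
    ∀ i : Fin n, y i = f i m (fun j : Fin i => y ⟨j, j.2.trans i.2⟩) + z (t₀ + i)}

/-- `f` is a uniform zero-error feedback code: for every starting time, distinct messages never
result in the same channel output sequence. -/
def IsUniformZeroErrorFeedbackCode {M n : ℕ}
    (f : (i : Fin n) → Fin M → (Fin i → ZMod q) → ZMod q) : Prop :=
  ∀ (t₀ : ℕ) (m m' : Fin M), m ≠ m' → Disjoint (N.codeOutputs f t₀ m) (N.codeOutputs f t₀ m')

/-- The zero-error feedback capacity `C₀f` of the channel (in bits per channel use): the supremum
of the rates `log₂ M / n` of the uniform zero-error feedback codes. -/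
def zeroErrorFeedbackCapacity : ℝ :=
  sSup {R : ℝ | ∃ M n : ℕ, 0 < M ∧ 0 < n ∧
    (∃ f : (i : Fin n) → Fin M → (Fin i → ZMod q) → ZMod q,
      N.IsUniformZeroErrorFeedbackCode f) ∧
    R = Real.logb 2 (M : ℝ) / (n : ℝ)}

end NoiseMachine

/-! ### The closed loop -/

/-- A coder-controller: the coder maps the plant states up to now to a channel input, and the
controller maps the channel outputs up to now to a control input. There is no feedback link from
the channel output to the coder. -/
structure CoderController (q nx nu : ℕ) where
  coder : (t : ℕ) → (Fin (t + 1) → (Fin nx → ℝ)) → ZMod q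
  controller : (t : ℕ) → (Fin (t + 1) → ZMod q) → (Fin nu → ℝ)

/-- The plant state `X` and the channel output `Y` evolve in closed loop with the
coder-controller `c`, the plant noise `V` and the channel noise `Z`. -/
structure IsClosedLoop {q nx nu : ℕ} {Ω : Type*}
    (A : Matrix (Fin nx) (Fin nx) ℝ) (B : Matrix (Fin nx) (Fin nu) ℝ)
    (c : CoderController q nx nu)
    (V : Ω → ℕ → (Fin nx → ℝ)) (Z : Ω → ℕ → ZMod q)
    (X : Ω → ℕ → (Fin nx → ℝ)) (Y : Ω → ℕ → ZMod q) : Prop where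
  channel : ∀ π t, Y π t = c.coder t (fun i => X π i) + Z π t
  plant : ∀ π t, X π (t + 1) = A *ᵥ X π t + B *ᵥ c.controller t (fun i => Y π i) + V π t

/-- The standing assumptions on the uncertain initial state `X₁`, plant noise `V` and channel
noise `Z`: uniform bounds on the initial state and on the plant noise; the initial state, the
plant noise and the channel noise are mutually unrelated (the joint range is the product of the
marginal ranges); the zero plant noise sequence is possible; and the possible channel noise
sequences are those generated by the finite-state machine `N`. -/
structure UncertaintyAssumptions {q nx : ℕ} {σ Ω : Type*} (N : NoiseMachine q σ) (Dx D : ℝ)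
    (X₁ : Ω → (Fin nx → ℝ)) (V : Ω → ℕ → (Fin nx → ℝ)) (Z : Ω → ℕ → ZMod q) : Prop where
  init_le : ∀ π, ‖X₁ π‖ ≤ Dx
  noise_le : ∀ π t, ‖V π t‖ ≤ D
  unrelated : Set.range (fun π => (X₁ π, V π, Z π)) =
    Set.range X₁ ×ˢ Set.range V ×ˢ Set.range Z
  zero_noise : ∃ π, ∀ t, V π t = 0
  channel_noise : Set.range Z = N.noiseSequences

/-- Uniform boundedness of a sequence of uncertain vectors. -/
def UniformlyBounded {nx : ℕ} {Ω : Type*} (X : Ω → ℕ → (Fin nx → ℝ)) : Prop :=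
  ∃ R : ℝ, ∀ π t, ‖X π t‖ ≤ R

end

noncomputable section

namespace NoiseMachine

variable {q : ℕ} {σ : Type*} (N : NoiseMachine q σ)

/-! ### Noise words -/

/-! Sufficiency rests on a capacity bound and a control scheme. If the zero-error feedback capacity
`C` is positive, then `log q ≤ C + h_ch`. To see this, send `n` symbols uncoded. Feedback shows the
sender the noise word that occurred, one of about `2 ^ (n h_ch)` possible ones, and a zero-error
code of rate `r < C` then reports it in about `n h_ch / r` further uses. This conveys `n log q` bits
without error, so `r log q ≤ C (r + h_ch)`; let `r → C` (`logb_le_capacity_add_entropy`). Hence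
`h_lin + h_ch < log q` gives `h_lin < C`.

A code of rate above `h_lin` can then name the cells of a partition of the error ball that are so
fine that `A ^ n` maps each to a set of half the radius (`eventually_exists_covering`). The
controller keeps a state estimate and corrects it once per block by the decoded cell, which keeps
the error bounded; feeding the estimate back through a stabilizing gain bounds the state. The coder
has no feedback link, but the plant serves as one: the controller adds to its input a signal
encoding the last output, the signals being further than `2 D` apart after `B`. So the states reveal
all earlier outputs (`Explains.eq`).

Necessity is a count of output words. With zero plant noise, `k` outputs determine the controls, so
two initial states with the same outputs drift apart by `A ^ k`. In a bounded loop, outputs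
therefore distinguish initial states that `A ^ k` separates by more than `2 R`, and then also the
noise word. About `2 ^ (k h_lin)` such states and the noise words are encoded injectively in `q ^ k`
outputs (`IsClosedLoop.card_mul_ncard_le`). Both halves compare volumes on the strictly unstable
part `A₁` of `A`, where `log |det A₁| = h_lin`. -/

theorem shift_mem_noiseSequences {z : ℕ → ZMod q} (hz : z ∈ N.noiseSequences) (k : ℕ) :
    (fun i => z (k + i)) ∈ N.noiseSequences := by
  obtain ⟨s, hs, hz⟩ := hz
  exact ⟨fun i => s (k + i), fun i => hs (k + i), fun i => hz (k + i)⟩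

/-- The first `n` values of `w` are the beginning of a possible noise sequence. -/
def IsNoiseWindow (n : ℕ) (w : ℕ → ZMod q) : Prop :=
  ∃ z ∈ N.noiseSequences, ∀ i < n, w i = z i

variable {N} in
theorem IsNoiseWindow.left {n k : ℕ} {w : ℕ → ZMod q} (h : N.IsNoiseWindow (n + k) w) :
    N.IsNoiseWindow n w := by
  obtain ⟨z, hz, h⟩ := h
  exact ⟨z, hz, fun i hi => h i (by omega)⟩

variable {N} in
theorem IsNoiseWindow.right {n k : ℕ} {w : ℕ → ZMod q} (h : N.IsNoiseWindow (n + k) w) :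
    N.IsNoiseWindow k (fun i => w (n + i)) := by
  obtain ⟨z, hz, h⟩ := h
  exact ⟨_, N.shift_mem_noiseSequences hz n, fun i hi => h (n + i) (by omega)⟩

variable {N} in
theorem IsNoiseWindow.congr {n : ℕ} {w w' : ℕ → ZMod q} (h : N.IsNoiseWindow n w)
    (hw : ∀ i < n, w' i = w i) : N.IsNoiseWindow n w' := by
  obtain ⟨z, hz, h⟩ := h
  exact ⟨z, hz, fun i hi => (hw i hi).trans (h i hi)⟩

/-- The possible noise words of length `n`. -/
def noiseWords (n : ℕ) : Set (Fin n → ZMod q) :=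
  {w | ∃ z ∈ N.noiseSequences, ∀ i : Fin n, w i = z i}

/-- The labels along a walk with `n` edges. -/
def walkLabels {n : ℕ} (s : Fin (n + 1) → σ) : Fin n → ZMod q :=
  fun i => N.label (s i.castSucc) (s i.succ)

theorem walkLabels_mem_noiseWords {n : ℕ} {s : Fin (n + 1) → σ} (hs : s ∈ N.stateSequences n) :
    N.walkLabels s ∈ N.noiseWords n := by
  choose next hnext using N.exists_edge
  -- Truncated subtraction: the walk follows `s` up to index `n` and `next` afterwards.
  let s' : ℕ → σ := fun i => next^[i - n] (s ⟨min i n, by omega⟩)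
  have hlt : ∀ i : Fin n, s' i = s i.castSucc ∧ s' (i + 1) = s i.succ := by
    intro i
    have h1 : (i : ℕ) - n = 0 := by omega
    have h2 : (i : ℕ) + 1 - n = 0 := by omega
    have h3 : min (i : ℕ) n = i := by omega
    have h4 : min ((i : ℕ) + 1) n = i + 1 := by omega
    constructor
    · simp only [s', h1, h3, Function.iterate_zero, id]
      rfl
    · simp only [s', h2, h4, Function.iterate_zero, id]
      rfl
  refine ⟨fun i => N.label (s' i) (s' (i + 1)), ⟨s', fun i => ?_, fun i => rfl⟩, fun i => ?_⟩
  · by_cases hi : i < n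
    · have := hlt ⟨i, hi⟩
      simp only at this
      rw [this.1, this.2]
      exact hs ⟨i, hi⟩
    · have h1 : i + 1 - n = (i - n) + 1 := by omega
      have h2 : min i n = n := by omega
      have h3 : min (i + 1) n = n := by omega
      simp only [s', h1, h2, h3, Function.iterate_succ_apply']
      exact hnext _
  · simp only [(hlt i).1, (hlt i).2]
    rfl

theorem noiseWords_eq_image (n : ℕ) : N.noiseWords n = N.walkLabels '' N.stateSequences n := by
  apply Set.Subset.antisymm
  · rintro w ⟨z, ⟨s, hs, hz⟩, hw⟩
    refine ⟨fun i => s i, fun i => hs i, ?_⟩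
    ext1 i
    rw [hw i, hz]
    rfl
  · rintro _ ⟨s, hs, rfl⟩
    exact N.walkLabels_mem_noiseWords hs

/-- A state and the label of the outgoing edge determine the successor, so the walk is recovered
step by step. -/
theorem eq_of_walkLabels_eq {n : ℕ} {s s' : Fin (n + 1) → σ} (hs : s ∈ N.stateSequences n)
    (hs' : s' ∈ N.stateSequences n) (h0 : s 0 = s' 0) (h : N.walkLabels s = N.walkLabels s') :
    s = s' := by
  ext1 i
  induction i using Fin.induction with
  | zero => exact h0
  | succ i ih =>
    have h1 := congrFun h i
    simp only [walkLabels, ih] at h1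
    have h2 := hs i
    rw [ih] at h2
    exact N.label_injective _ _ _ h2 (hs' i) h1

theorem ncard_noiseWords_le [Finite σ] (n : ℕ) :
    (N.noiseWords n).ncard ≤ (N.stateSequences n).ncard := by
  rw [noiseWords_eq_image]
  exact Set.ncard_image_le (Set.toFinite _)

/-- Passing to labels loses only the initial state. Together with `ncard_noiseWords_le`, noise words
and walks grow at the same exponential rate. -/
theorem ncard_stateSequences_le_mul [NeZero q] [Finite σ] (n : ℕ) :
    (N.stateSequences n).ncard ≤ Nat.card σ * (N.noiseWords n).ncard := by
  rw [← Nat.card_coe_set_eq, ← Nat.card_coe_set_eq, ← Nat.card_prod]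
  refine Nat.card_le_card_of_injective
    (fun s : N.stateSequences n =>
      ((s.1 0, ⟨_, N.walkLabels_mem_noiseWords s.2⟩) : σ × N.noiseWords n)) ?_
  intro s s' h
  simp only [Prod.mk.injEq, Subtype.mk.injEq] at h
  exact Subtype.ext (N.eq_of_walkLabels_eq s.2 s'.2 h.1 h.2)

theorem stateSequences_nonempty [Nonempty σ] (n : ℕ) : (N.stateSequences n).Nonempty := by
  choose next hnext using N.exists_edge
  refine ⟨fun i => next^[i] (Classical.arbitrary σ), fun i => ?_⟩
  simp only [Fin.val_castSucc, Fin.val_succ, Function.iterate_succ_apply']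
  exact hnext _

/-! ### Entropy -/

theorem one_le_ncard_stateSequences [Finite σ] [Nonempty σ] (n : ℕ) :
    (1 : ℝ) ≤ (N.stateSequences n).ncard := by
  have := (Set.ncard_pos (Set.toFinite _)).2 (N.stateSequences_nonempty n)
  exact_mod_cast this

/-- A real `limsup` is meaningful only for bounded sequences. The factor 2 bounds `(n + 1) / n`,
since a walk with `n` edges has `n + 1` vertices. -/
theorem logb_ncard_stateSequences_div_le [Finite σ] [Nonempty σ] (n : ℕ) :
    Real.logb 2 ((N.stateSequences n).ncard : ℝ) / n ≤ 2 * Real.logb 2 (Nat.card σ) := by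
  have hc : (1 : ℝ) ≤ Nat.card σ := by exact_mod_cast Nat.card_pos
  have hl : 0 ≤ Real.logb 2 (Nat.card σ) := Real.logb_nonneg (by norm_num) hc
  rcases Nat.eq_zero_or_pos n with rfl | hn
  · simpa using hl
  have h1 : (N.stateSequences n).ncard ≤ Nat.card σ ^ (n + 1) := by
    rw [← Nat.card_coe_set_eq]
    refine (Nat.card_le_card_of_injective _ Subtype.val_injective).trans ?_
    rw [Nat.card_fun]
    simp
  have h2 : Real.logb 2 ((N.stateSequences n).ncard : ℝ) ≤ (n + 1) * Real.logb 2 (Nat.card σ) := by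
    have : (n + 1) * Real.logb 2 (Nat.card σ) = Real.logb 2 ((Nat.card σ : ℝ) ^ (n + 1)) := by
      rw [Real.logb_pow]; push_cast; ring
    rw [this]
    refine Real.logb_le_logb_of_le (by norm_num) ?_ (by exact_mod_cast h1)
    linarith [N.one_le_ncard_stateSequences n]
  have hn' : (1 : ℝ) ≤ n := by exact_mod_cast hn
  rw [div_le_iff₀ (by positivity)]
  nlinarith

theorem logb_ncard_stateSequences_div_nonneg [Finite σ] [Nonempty σ] (n : ℕ) :
    0 ≤ Real.logb 2 ((N.stateSequences n).ncard : ℝ) / n :=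
  div_nonneg (Real.logb_nonneg (by norm_num) (N.one_le_ncard_stateSequences n)) (by positivity)

theorem isBoundedUnder_le_growth [Finite σ] [Nonempty σ] :
    Filter.IsBoundedUnder (· ≤ ·) Filter.atTop
      (fun n : ℕ => Real.logb 2 ((N.stateSequences n).ncard : ℝ) / (n : ℝ)) :=
  Filter.isBoundedUnder_of ⟨_, N.logb_ncard_stateSequences_div_le⟩

theorem isCoboundedUnder_le_growth [Finite σ] [Nonempty σ] :
    Filter.IsCoboundedUnder (· ≤ ·) Filter.atTop
      (fun n : ℕ => Real.logb 2 ((N.stateSequences n).ncard : ℝ) / (n : ℝ)) :=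
  (Filter.isBoundedUnder_of ⟨0, N.logb_ncard_stateSequences_div_nonneg⟩ :
    Filter.IsBoundedUnder (· ≥ ·) _ _).isCoboundedUnder_le

theorem eventually_logb_lt_of_entropy_lt [Finite σ] [Nonempty σ] {h : ℝ} (hh : N.entropy < h) :
    ∀ᶠ n : ℕ in Filter.atTop, Real.logb 2 ((N.stateSequences n).ncard : ℝ) ≤ n * h := by
  filter_upwards [Filter.eventually_lt_of_limsup_lt hh N.isBoundedUnder_le_growth,
    Filter.eventually_gt_atTop 0] with n hn hn0
  have : (0 : ℝ) < n := by exact_mod_cast hn0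
  rw [div_lt_iff₀ this] at hn
  linarith

/-- A `limsup` gives lower bounds only along infinitely many lengths; the necessity argument needs
just one large length. -/
theorem frequently_lt_logb_of_lt_entropy [Finite σ] [Nonempty σ] {h : ℝ} (hh : h < N.entropy) :
    ∃ᶠ n : ℕ in Filter.atTop, n * h ≤ Real.logb 2 ((N.stateSequences n).ncard : ℝ) := by
  refine ((Filter.frequently_lt_of_lt_limsup N.isCoboundedUnder_le_growth hh).and_eventually
    (Filter.eventually_gt_atTop 0)).mono ?_
  rintro n ⟨hn, hn0⟩
  have : (0 : ℝ) < n := by exact_mod_cast hn0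
  rw [lt_div_iff₀ this] at hn
  linarith

theorem entropy_nonneg [Finite σ] [Nonempty σ] : 0 ≤ N.entropy :=
  Filter.le_limsup_of_frequently_le
    (Filter.Frequently.of_forall N.logb_ncard_stateSequences_div_nonneg)
    N.isBoundedUnder_le_growth

/-! ### Feedback codes -/

/-- A zero-error feedback code of blocklength `n` with messages in `M`: the `i`-th input is a
function of the message and of the outputs before `i`, and no output word is compatible with two
messages. -/
structure IsFeedbackCode (n : ℕ) {M : Type*} (g : ℕ → M → (ℕ → ZMod q) → ZMod q) : Prop where
  causal : ∀ i m y y', (∀ j < i, y j = y' j) → g i m y = g i m y'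
  injective : ∀ y m m', N.IsNoiseWindow n (fun i => y i - g i m y) →
    N.IsNoiseWindow n (fun i => y i - g i m' y) → m = m'

/-- There is a zero-error feedback code of blocklength `n` with `k` messages. -/
def HasFeedbackCode (n k : ℕ) : Prop :=
  ∃ g : ℕ → Fin k → (ℕ → ZMod q) → ZMod q, N.IsFeedbackCode n g

variable {N}

theorem IsFeedbackCode.comap {n : ℕ} {M M' : Type*} {g : ℕ → M → (ℕ → ZMod q) → ZMod q}
    (hg : N.IsFeedbackCode n g) {φ : M' → M} (hφ : Function.Injective φ) :
    N.IsFeedbackCode n (fun i m y => g i (φ m) y) :=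
  ⟨fun i m => hg.causal i (φ m), fun y _ _ h h' => hφ (hg.injective y _ _ h h')⟩

theorem IsFeedbackCode.hasFeedbackCode {n k : ℕ} {M : Type*} [Finite M]
    {g : ℕ → M → (ℕ → ZMod q) → ZMod q} (hg : N.IsFeedbackCode n g) (hk : k = Nat.card M) :
    N.HasFeedbackCode n k := by
  subst hk
  exact ⟨_, hg.comap (Finite.equivFin M).symm.injective⟩

/-- Transmission of a second message, which may depend on the outputs of the first block. -/
theorem IsFeedbackCode.append {n k : ℕ} {M M' : Type*} {g : ℕ → M → (ℕ → ZMod q) → ZMod q}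
    {g' : ℕ → M' → (ℕ → ZMod q) → ZMod q} (φ : M → (ℕ → ZMod q) → M')
    (hgc : ∀ i m y y', (∀ j < i, y j = y' j) → g i m y = g i m y')
    (hφc : ∀ m y y', (∀ j < n, y j = y' j) → φ m y = φ m y')
    (hg' : N.IsFeedbackCode k g')
    (hφ : ∀ y m m', N.IsNoiseWindow n (fun i => y i - g i m y) →
      N.IsNoiseWindow n (fun i => y i - g i m' y) → φ m y = φ m' y → m = m') :
    N.IsFeedbackCode (n + k)
      (fun i m y => if i < n then g i m y else g' (i - n) (φ m y) (fun j => y (n + j))) := by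
  refine ⟨fun i m y y' h => ?_, fun y m m' h h' => ?_⟩
  · by_cases hi : i < n
    · simp only [hi, if_true]
      exact hgc i m y y' h
    · simp only [hi, if_false]
      rw [hφc m y y' fun j hj => h j (by omega)]
      exact hg'.causal _ _ _ _ fun j hj => h _ (by omega)
  · have hl : ∀ m, N.IsNoiseWindow (n + k) (fun i => y i - if i < n then g i m y else
        g' (i - n) (φ m y) (fun j => y (n + j))) →
        N.IsNoiseWindow n (fun i => y i - g i m y) :=
      fun m h => h.left.congr fun i hi => by simp [hi]
    have hr : ∀ m, N.IsNoiseWindow (n + k) (fun i => y i - if i < n then g i m y else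
        g' (i - n) (φ m y) (fun j => y (n + j))) →
        N.IsNoiseWindow k (fun i => y (n + i) - g' i (φ m y) (fun j => y (n + j))) :=
      fun m h => h.right.congr fun i hi => by simp
    -- The second message is decoded first and resolves what the first block leaves ambiguous.
    exact hφ y m m' (hl m h) (hl m' h') (hg'.injective _ _ _ (hr m h) (hr m' h'))

theorem HasFeedbackCode.mul {n k a b : ℕ} (h : N.HasFeedbackCode n a)
    (h' : N.HasFeedbackCode k b) : N.HasFeedbackCode (n + k) (a * b) := by
  obtain ⟨g, hg⟩ := h
  obtain ⟨g', hg'⟩ := h'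
  refine (IsFeedbackCode.append (M := Fin a × Fin b) (g := fun i m y => g i m.1 y)
    (fun m _ => m.2) (fun i m => hg.causal i m.1) (fun _ _ _ _ => rfl) hg' ?_).hasFeedbackCode
    (by simp)
  rintro y ⟨m, l⟩ ⟨m', l'⟩ h1 h2 h3
  exact Prod.ext (hg.injective y m m' h1 h2) h3

theorem hasFeedbackCode_zero_one : N.HasFeedbackCode 0 1 :=
  ⟨fun _ _ _ => 0, fun _ _ _ _ _ => rfl, fun _ _ _ _ _ => Subsingleton.elim _ _⟩

theorem HasFeedbackCode.pow {n a : ℕ} (h : N.HasFeedbackCode n a) (j : ℕ) :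
    N.HasFeedbackCode (j * n) (a ^ j) := by
  induction j with
  | zero => simpa using hasFeedbackCode_zero_one
  | succ j ih => rw [Nat.succ_mul, pow_succ]; exact ih.mul h

/-- Send `n` uncoded symbols, then tell the receiver the noise that occurred. -/
theorem HasFeedbackCode.uncoded [NeZero q] [Nonempty σ] {n k a : ℕ} (h : N.HasFeedbackCode k a)
    (ha : (N.noiseWords n).ncard ≤ a) : N.HasFeedbackCode (n + k) (q ^ n) := by
  obtain ⟨g', hg'⟩ := h
  have ha0 : 0 < a := by
    obtain ⟨s, hs⟩ := N.stateSequences_nonempty n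
    exact lt_of_lt_of_le ((Set.ncard_pos (Set.toFinite _)).2
      ⟨_, N.walkLabels_mem_noiseWords hs⟩) ha
  -- A numbering of the noise words by messages of the second code; its values at other words are
  -- irrelevant.
  obtain ⟨e, he⟩ : ∃ e : (Fin n → ZMod q) → Fin a, Set.InjOn e (N.noiseWords n) := by
    have := Fintype.ofFinite (N.noiseWords n)
    have hcard : Fintype.card (N.noiseWords n) ≤ Fintype.card (Fin a) := by
      rwa [Fintype.card_fin, ← Nat.card_eq_fintype_card, Nat.card_coe_set_eq]
    obtain ⟨f⟩ := Function.Embedding.nonempty_of_card_le hcard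
    refine ⟨Function.extend Subtype.val f fun _ => ⟨0, ha0⟩, fun w hw w' hw' h => ?_⟩
    have hval : ∀ v : N.noiseWords n,
        Function.extend Subtype.val f (fun _ => ⟨0, ha0⟩) (v : Fin n → ZMod q) = f v :=
      fun v => Subtype.val_injective.extend_apply _ _ _
    have := hval ⟨w, hw⟩ ▸ hval ⟨w', hw'⟩ ▸ h
    exact congrArg Subtype.val (f.injective this)
  -- By feedback the sender knows the noise `y i - m i` of the first block and sends its number. The
  -- receiver then subtracts the noise.
  refine (IsFeedbackCode.append (n := n) (M := Fin n → ZMod q)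
    (g := fun i m y => if hi : i < n then m ⟨i, hi⟩ else 0)
    (fun m y => e fun i => y i - m i) (fun _ _ _ _ _ => rfl) ?_ hg' ?_).hasFeedbackCode
    (by simp)
  · intro m y y' h
    simp only [fun i : Fin n => h i i.2]
  · intro y m m' h1 h2 h3
    have key : ∀ m : Fin n → ZMod q, N.IsNoiseWindow n
        (fun i => y i - if hi : i < n then m ⟨i, hi⟩ else 0) →
        (fun i : Fin n => y i - m i) ∈ N.noiseWords n := by
      rintro m ⟨z, hz, h⟩
      refine ⟨z, hz, fun i => ?_⟩
      have := h i i.2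
      simpa using this
    have := he (key m h1) (key m' h2) h3
    ext1 i
    simpa using congrFun this i

/-! ### The capacity formula -/

theorem IsUniformZeroErrorFeedbackCode.hasFeedbackCode {M n : ℕ}
    {f : (i : Fin n) → Fin M → (Fin i → ZMod q) → ZMod q}
    (hf : N.IsUniformZeroErrorFeedbackCode f) : N.HasFeedbackCode n M := by
  refine ⟨fun i m y => if hi : i < n then f ⟨i, hi⟩ m (fun j => y j) else 0, ?_, ?_⟩
  · intro i m y y' h
    simp only [fun j : Fin i => h j j.2]
  · intro y m m' h h'
    by_contra hne
    have key : ∀ m, N.IsNoiseWindow n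
        (fun i => y i - if hi : i < n then f ⟨i, hi⟩ m (fun j => y j) else 0) →
        (fun i : Fin n => y i) ∈ N.codeOutputs f 0 m := by
      rintro m ⟨z, hz, h⟩
      refine ⟨z, hz, fun i => ?_⟩
      have := h i i.2
      simp only [i.2, dif_pos] at this
      rw [zero_add, ← this]
      simp
    exact Set.disjoint_left.1 (hf 0 m m' hne) (key m h) (key m' h')

/-- A noise window at any starting time begins a shifted noise sequence, so starting time zero
already gives uniformity. -/
theorem HasFeedbackCode.exists_uniform {M n : ℕ} (h : N.HasFeedbackCode n M) :
    ∃ f : (i : Fin n) → Fin M → (Fin i → ZMod q) → ZMod q,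
      N.IsUniformZeroErrorFeedbackCode f := by
  obtain ⟨g, hg⟩ := h
  refine ⟨fun i m y => g i m (fun j => if hj : j < i then y ⟨j, hj⟩ else 0), ?_⟩
  intro t₀ m m' hne
  refine Set.disjoint_left.2 fun y h h' => hne ?_
  have key : ∀ m, y ∈ N.codeOutputs (fun (i : Fin n) m (y : Fin i → ZMod q) =>
      g i m (fun j => if hj : j < i then y ⟨j, hj⟩ else 0)) t₀ m →
      N.IsNoiseWindow n (fun i => (if hi : i < n then y ⟨i, hi⟩ else 0) -
        g i m (fun j => if hj : j < n then y ⟨j, hj⟩ else 0)) := by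
    rintro m ⟨z, hz, h⟩
    refine ⟨_, N.shift_mem_noiseSequences hz t₀, fun i hi => ?_⟩
    simp only [dif_pos hi]
    rw [h ⟨i, hi⟩, sub_eq_iff_eq_add, add_comm]
    refine congrArg _ (hg.causal i m _ _ fun j hj => ?_)
    simp [hj, hj.trans hi]
  exact hg.injective (fun i => if hi : i < n then y ⟨i, hi⟩ else 0) m m' (key m h) (key m' h')

/-- Positivity of the capacity rules out an unbounded set of rates, for which `sSup` would be 0 by
convention. -/
theorem HasFeedbackCode.rate_le_capacity (hC : 0 < N.zeroErrorFeedbackCapacity) {n M : ℕ}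
    (hn : 0 < n) (hM : 0 < M) (h : N.HasFeedbackCode n M) :
    Real.logb 2 M ≤ N.zeroErrorFeedbackCapacity * n := by
  have hn' : (0 : ℝ) < n := by exact_mod_cast hn
  rw [← div_le_iff₀ hn']
  refine le_csSup ?_ ⟨M, n, hM, hn, h.exists_uniform, rfl⟩
  by_contra hb
  rw [zeroErrorFeedbackCapacity, Real.sSup_of_not_bddAbove hb] at hC
  exact lt_irrefl _ hC

theorem exists_hasFeedbackCode_of_lt_capacity (hC : 0 < N.zeroErrorFeedbackCapacity) {r : ℝ}
    (hr : r < N.zeroErrorFeedbackCapacity) :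
    ∃ n M : ℕ, 0 < n ∧ 0 < M ∧ N.HasFeedbackCode n M ∧ r * n < Real.logb 2 M := by
  have hne : {R : ℝ | ∃ M n : ℕ, 0 < M ∧ 0 < n ∧
      (∃ f : (i : Fin n) → Fin M → (Fin i → ZMod q) → ZMod q,
        N.IsUniformZeroErrorFeedbackCode f) ∧
      R = Real.logb 2 (M : ℝ) / (n : ℝ)}.Nonempty := by
    by_contra h
    rw [zeroErrorFeedbackCapacity, Set.not_nonempty_iff_eq_empty.1 h, Real.sSup_empty] at hC
    exact lt_irrefl _ hC
  obtain ⟨_, ⟨M, n, hM, hn, ⟨f, hf⟩, rfl⟩, hlt⟩ := exists_lt_of_lt_csSup hne hr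
  have hn' : (0 : ℝ) < n := by exact_mod_cast hn
  exact ⟨n, M, hn, hM, hf.hasFeedbackCode, (lt_div_iff₀ hn').1 hlt⟩

/-- The rate of the code that sends `n` uncoded symbols and then the noise word in `j` blocks of
length `k` is at most the capacity; let `n → ∞`. -/
theorem mul_logb_le_capacity_mul [NeZero q] [Finite σ] [Nonempty σ]
    (hC : 0 < N.zeroErrorFeedbackCapacity) {r h : ℝ}
    (hr0 : 0 < r) (hr : r < N.zeroErrorFeedbackCapacity) (hh : N.entropy < h) :
    r * Real.logb 2 q ≤ N.zeroErrorFeedbackCapacity * (r + h) := by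
  obtain ⟨k, M, hk, hM, hcode, hrate⟩ := exists_hasFeedbackCode_of_lt_capacity hC hr
  set C := N.zeroErrorFeedbackCapacity
  have hk' : (0 : ℝ) < k := by exact_mod_cast hk
  have hh0 : 0 < h := N.entropy_nonneg.trans_lt hh
  have hq : (0 : ℝ) < q := by exact_mod_cast NeZero.pos q
  have key : ∀ᶠ n : ℕ in Filter.atTop,
      r * Real.logb 2 q ≤ C * (r + h) + C * r * k * (n : ℝ)⁻¹ := by
    filter_upwards [N.eventually_logb_lt_of_entropy_lt hh, Filter.eventually_gt_atTop 0]
      with n hn hn0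
    have hn' : (0 : ℝ) < n := by exact_mod_cast hn0
    -- Enough repetitions for `M ^ j ≥ 2 ^ (n h)`. Rounding up costs less than one block, which is
    -- the `1 / n` term above.
    set j := ⌈n * h / (r * k)⌉₊ with hj
    have hj1 : n * h ≤ j * (r * k) := by
      rw [← div_le_iff₀ (by positivity)]
      exact Nat.le_ceil _
    have hj2 : (j : ℝ) * (r * k) ≤ n * h + r * k := by
      have : (j : ℝ) < n * h / (r * k) + 1 := Nat.ceil_lt_add_one (by positivity)
      rw [← sub_lt_iff_lt_add, lt_div_iff₀ (by positivity)] at this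
      linarith
    have hwords : (N.noiseWords n).ncard ≤ M ^ j := by
      refine (N.ncard_noiseWords_le n).trans ?_
      have hMj : (0 : ℝ) < (M : ℝ) ^ j := by positivity
      have h1 : Real.logb 2 ((N.stateSequences n).ncard : ℝ) ≤ Real.logb 2 ((M : ℝ) ^ j) := by
        rw [Real.logb_pow]
        refine hn.trans (hj1.trans ?_)
        gcongr
      have := (Real.logb_le_logb (by norm_num)
        (by linarith [N.one_le_ncard_stateSequences n]) hMj).1 h1
      exact_mod_cast this
    have hrate' := ((hcode.pow j).uncoded hwords).rate_le_capacity hC (by omega)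
      (pow_pos (NeZero.pos q) n)
    push_cast at hrate'
    rw [Real.logb_pow] at hrate'
    have h2 : r * (n * Real.logb 2 q) ≤ C * (r * n + n * h + r * k) := by
      calc r * (n * Real.logb 2 q) ≤ r * (C * (n + j * k)) := by gcongr
        _ = C * (r * n + j * (r * k)) := by ring
        _ ≤ C * (r * n + (n * h + r * k)) := by gcongr
        _ = _ := by ring
    have h3 : C * (r + h) + C * r * k * (n : ℝ)⁻¹ = C * (r * n + n * h + r * k) / n := by
      field_simp
    rw [h3, le_div_iff₀ hn']
    linarith
  have hlim : Filter.Tendsto (fun n : ℕ => C * (r + h) + C * r * k * (n : ℝ)⁻¹) Filter.atTop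
      (nhds (C * (r + h) + C * r * k * 0)) :=
    (tendsto_inv_atTop_nhds_zero_nat.const_mul _).const_add _
  simpa using ge_of_tendsto hlim key

/-- A positive zero-error feedback capacity is at least `log₂ q - h`, where `h` is the entropy of
the noise. -/
theorem logb_le_capacity_add_entropy [NeZero q] [Finite σ] [Nonempty σ]
    (hC : 0 < N.zeroErrorFeedbackCapacity) :
    Real.logb 2 q ≤ N.zeroErrorFeedbackCapacity + N.entropy := by
  set C := N.zeroErrorFeedbackCapacity
  have h1 : ∀ r, 0 < r → r < C → r * Real.logb 2 q ≤ C * (r + N.entropy) := by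
    intro r hr0 hr
    refine le_of_forall_pos_le_add fun ε hε => ?_
    have := mul_logb_le_capacity_mul hC hr0 hr
      (show N.entropy < N.entropy + ε / C by have := div_pos hε hC; linarith)
    have h2 : C * (r + (N.entropy + ε / C)) = C * (r + N.entropy) + ε := by
      field_simp
      ring
    linarith
  -- The capacity itself need not be attained by a code, hence a limit from the left.
  have h3 : C * Real.logb 2 q ≤ C * (C + N.entropy) := by
    have hlim1 : Filter.Tendsto (fun r : ℝ => r * Real.logb 2 q) (nhdsWithin C (Set.Iio C))
        (nhds (C * Real.logb 2 q)) :=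
      (Continuous.tendsto (by fun_prop) C).mono_left nhdsWithin_le_nhds
    have hlim2 : Filter.Tendsto (fun r : ℝ => C * (r + N.entropy)) (nhdsWithin C (Set.Iio C))
        (nhds (C * (C + N.entropy))) :=
      (Continuous.tendsto (by fun_prop) C).mono_left nhdsWithin_le_nhds
    refine le_of_tendsto_of_tendsto hlim1 hlim2 ?_
    filter_upwards [Ioo_mem_nhdsLT hC] with r hr
    exact h1 r hr.1 hr.2
  exact le_of_mul_le_mul_left h3 hC

end NoiseMachine

section

/-! ### Growth of matrix powers -/

theorem norm_complexify {d : ℕ} (x : Fin d → ℝ) : ‖fun i => (x i : ℂ)‖ = ‖x‖ := by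
  simp [Pi.norm_def]

open scoped Matrix.Norms.Operator in
/-- If the eigenvalues of `M` have modulus less than `r` then the powers of `M` grow at most like
those of some `s < r`. -/
theorem exists_norm_pow_mulVec_le {d : ℕ} (M : Matrix (Fin d) (Fin d) ℝ) {r : ℝ} (hr : 0 < r)
    (hM : ∀ μ ∈ complexEigenvalues M, ‖μ‖ < r) :
    ∃ C s : ℝ, 0 < C ∧ 0 < s ∧ s < r ∧ ∀ (n : ℕ) (x : Fin d → ℝ),
      ‖(M ^ n) *ᵥ x‖ ≤ C * s ^ n * ‖x‖ := by
  set a : Matrix (Fin d) (Fin d) ℂ := M.map (algebraMap ℝ ℂ) with ha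
  have hchar : a.charpoly ≠ 0 := a.charpoly_monic.ne_zero
  have hspec : ∀ μ ∈ spectrum ℂ a, ‖μ‖ < r := fun μ hμ =>
    hM μ ((Polynomial.mem_roots hchar).2 (Matrix.mem_spectrum_iff_isRoot_charpoly.1 hμ))
  have hrad : spectralRadius ℂ a < ENNReal.ofReal r := by
    rcases (spectrum ℂ a).eq_empty_or_nonempty with h | h
    · simp [spectralRadius, h, hr]
    · have := spectrum.spectralRadius_lt_of_forall_lt_of_nonempty (r := ⟨r, hr.le⟩) h
        (fun μ hμ => hspec μ hμ)
      rwa [ENNReal.ofReal_eq_coe_nnreal hr.le]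
  -- The maximum with 0 makes `t` positive. By Gelfand's formula `‖a ^ n‖ ≤ t ^ n` for large `n`;
  -- the constant `C` absorbs the other powers.
  obtain ⟨t, ht1, ht2⟩ := exists_between (max_lt hrad (show (0 : ENNReal) < _ by simpa using hr))
  lift t to NNReal using ne_top_of_lt ht2
  have ht0 : 0 < t := by simpa using (le_max_right _ _).trans_lt ht1
  have htr : (t : ℝ) < r := by
    rw [ENNReal.ofReal, ENNReal.coe_lt_coe] at ht2
    exact Real.lt_toNNReal_iff_coe_lt.1 ht2
  have hev : ∀ᶠ n : ℕ in Filter.atTop, ‖a ^ n‖ / (t : ℝ) ^ n ≤ 1 := by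
    filter_upwards [(spectrum.pow_nnnorm_pow_one_div_tendsto_nhds_spectralRadius a).eventually
      (gt_mem_nhds ((le_max_left _ _).trans_lt ht1)), Filter.eventually_gt_atTop 0] with n hn hn0
    have hn' : (0 : ℝ) < n := by exact_mod_cast hn0
    have h1 : ((‖a ^ n‖₊ : ENNReal) ^ (1 / (n : ℝ))) ^ (n : ℝ) ≤ (t : ENNReal) ^ (n : ℝ) :=
      ENNReal.rpow_le_rpow hn.le hn'.le
    rw [← ENNReal.rpow_mul, one_div_mul_cancel hn'.ne', ENNReal.rpow_one,
      ENNReal.rpow_natCast] at h1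
    have h2 : ‖a ^ n‖₊ ≤ t ^ n := by exact_mod_cast h1
    rw [div_le_one (by positivity)]
    exact_mod_cast h2
  obtain ⟨C, hC⟩ := (Filter.isBoundedUnder_of_eventually_le hev).bddAbove_range
  refine ⟨max C 1, t, lt_max_of_lt_right one_pos, ht0, htr, fun n x => ?_⟩
  have hnorm : ‖a ^ n‖ ≤ max C 1 * (t : ℝ) ^ n := by
    rw [← div_le_iff₀ (by positivity)]
    exact (hC ⟨n, rfl⟩).trans (le_max_left _ _)
  have hmap : (fun i => (((M ^ n) *ᵥ x) i : ℂ)) = (a ^ n) *ᵥ (fun i => (x i : ℂ)) := by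
    rw [ha, ← Matrix.map_pow]
    ext i
    exact RingHom.map_mulVec (algebraMap ℝ ℂ) (M ^ n) x i
  rw [← norm_complexify, hmap, ← norm_complexify x]
  exact (Matrix.linfty_opNorm_mulVec _ _).trans (by gcongr)

/-! ### Splitting off the unstable part -/

open Polynomial

theorem mem_complexEigenvalues {n : ℕ} {A : Matrix (Fin n) (Fin n) ℝ} {μ : ℂ} :
    μ ∈ complexEigenvalues A ↔ aeval μ A.charpoly = 0 := by
  rw [complexEigenvalues, mem_roots (Matrix.charpoly_monic _).ne_zero, Matrix.charpoly_map,
    IsRoot, eval_map_algebraMap]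

/-- Spectral mapping: `p(μ)` lies in the spectrum of the zero matrix. -/
theorem aeval_eq_zero_of_mem_complexEigenvalues {n : ℕ} {A : Matrix (Fin n) (Fin n) ℝ} {μ : ℂ}
    (hμ : μ ∈ complexEigenvalues A) {p : ℝ[X]} (hp : aeval A p = 0) : aeval μ p = 0 := by
  set a : Matrix (Fin n) (Fin n) ℂ := A.map (algebraMap ℝ ℂ)
  have h1 : μ ∈ spectrum ℂ a :=
    Matrix.mem_spectrum_iff_isRoot_charpoly.2 (isRoot_of_mem_roots hμ)
  have h2 : aeval a (p.map (algebraMap ℝ ℂ)) = 0 := by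
    rw [aeval_map_algebraMap]
    have : a = (Algebra.ofId ℝ ℂ).mapMatrix A := rfl
    rw [this, aeval_algHom_apply, hp, map_zero]
  have h3 := spectrum.subset_polynomial_aeval a (p.map (algebraMap ℝ ℂ)) ⟨μ, h1, rfl⟩
  have : Nontrivial (Matrix (Fin n) (Fin n) ℂ) := by
    by_contra h
    rw [not_nontrivial_iff_subsingleton] at h
    rw [spectrum.of_subsingleton] at h1
    exact h1
  rw [h2, spectrum.zero_eq, Set.mem_singleton_iff] at h3
  simpa using h3

/-- The roots are conjugate over `ℝ`, and the only real automorphisms of `ℂ` are the identity and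
conjugation. -/
theorem norm_eq_of_irreducible {p : ℝ[X]} (hp : Irreducible p) {z w : ℂ} (hz : aeval z p = 0)
    (hw : aeval w p = 0) : ‖z‖ = ‖w‖ := by
  have h : IsConjRoot ℝ z w := by
    rw [IsConjRoot, ← minpoly.eq_of_irreducible hp hz, ← minpoly.eq_of_irreducible hp hw]
  have : IsAlgClosure ℝ ℂ := ⟨inferInstance, inferInstance⟩
  have : Normal ℝ ℂ := IsAlgClosure.normal ℝ ℂ
  obtain ⟨σ, rfl⟩ := isConjRoot_iff_exists_algEquiv.1 h
  rcases Complex.real_algHom_eq_id_or_conj σ.toAlgHom with h | h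
  · exact congrArg norm (DFunLike.congr_fun h w)
  · exact (congrArg norm (DFunLike.congr_fun h w)).trans (by simp)

/-- Every nonzero real polynomial factors into a part with roots outside the closed unit disc and a
part with roots inside. -/
theorem exists_factorization_unit_disc (p : ℝ[X]) (hp : p ≠ 0) :
    ∃ p₁ p₂ : ℝ[X], p = p₁ * p₂ ∧ (∀ z : ℂ, aeval z p₁ = 0 → 1 < ‖z‖) ∧
      ∀ z : ℂ, aeval z p₂ = 0 → ‖z‖ ≤ 1 := by
  induction p using UniqueFactorizationMonoid.induction_on_prime with
  | h₁ => exact absurd rfl hp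
  | h₂ p hu =>
    refine ⟨p, 1, (mul_one p).symm, fun z hz => ?_, fun z hz => ?_⟩
    · exact absurd hz (hu.map (aeval z)).ne_zero
    · simp at hz
  | h₃ a p ha hpr ih =>
    obtain ⟨p₁, p₂, rfl, h1, h2⟩ := ih ha
    -- All roots of a prime factor have the same modulus, so the factor goes whole to one side.
    by_cases h : ∀ z : ℂ, aeval z p = 0 → 1 < ‖z‖
    · refine ⟨p * p₁, p₂, (mul_assoc _ _ _).symm, fun z hz => ?_, h2⟩
      rw [map_mul, mul_eq_zero] at hz
      exact hz.elim (h z) (h1 z)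
    · push Not at h
      obtain ⟨w, hw, hw1⟩ := h
      refine ⟨p₁, p * p₂, by ring, h1, fun z hz => ?_⟩
      rw [map_mul, mul_eq_zero] at hz
      exact hz.elim (fun hz => (norm_eq_of_irreducible hpr.irreducible hz hw).trans_le hw1) (h2 z)

theorem aeval_intertwine {E F : Type*} [AddCommGroup E] [Module ℝ E] [AddCommGroup F] [Module ℝ F]
    {f : Module.End ℝ E} {g : Module.End ℝ F} (j : F →ₗ[ℝ] E) (h : ∀ x, j (g x) = f (j x))
    (p : ℝ[X]) (x : F) : j (aeval g p x) = aeval f p (j x) := by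
  induction p using Polynomial.induction_on' with
  | add p r hp hr => simp [hp, hr]
  | monomial k a =>
    have hk : ∀ k, j ((g ^ k) x) = (f ^ k) (j x) := by
      intro k
      induction k with
      | zero => simp
      | succ k ih => rw [pow_succ', Module.End.mul_apply, h, ih, pow_succ', Module.End.mul_apply]
    simp [aeval_monomial, hk]

/-- A linear change of coordinates that splits `A` into its strictly unstable part `A₁` and the
rest `A₂`. -/
structure UnstableSplitting {n : ℕ} (A : Matrix (Fin n) (Fin n) ℝ) {d₁ d₂ : ℕ}
    (A₁ : Matrix (Fin d₁) (Fin d₁) ℝ) (A₂ : Matrix (Fin d₂) (Fin d₂) ℝ)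
    (e : (Fin n → ℝ) ≃ₗ[ℝ] (Fin d₁ → ℝ) × (Fin d₂ → ℝ)) : Prop where
  map_mulVec : ∀ x, e (A *ᵥ x) = (A₁ *ᵥ (e x).1, A₂ *ᵥ (e x).2)
  unstable : ∀ μ ∈ complexEigenvalues A₁, 1 < ‖μ‖
  stable : ∀ μ ∈ complexEigenvalues A₂, ‖μ‖ ≤ 1

/-- Factor the characteristic polynomial at the unit circle. The factors have no common root, so the
kernels of their values at `A` are complementary invariant subspaces, each annihilated by its
factor. -/
theorem exists_unstableSplitting {n : ℕ} (A : Matrix (Fin n) (Fin n) ℝ) :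
    ∃ (d₁ d₂ : ℕ) (A₁ : Matrix (Fin d₁) (Fin d₁) ℝ) (A₂ : Matrix (Fin d₂) (Fin d₂) ℝ)
      (e : (Fin n → ℝ) ≃ₗ[ℝ] (Fin d₁ → ℝ) × (Fin d₂ → ℝ)), UnstableSplitting A A₁ A₂ e := by
  set f : Module.End ℝ (Fin n → ℝ) := Matrix.toLin' A with hf
  obtain ⟨p₁, p₂, hp, h1, h2⟩ :=
    exists_factorization_unit_disc f.charpoly f.charpoly_monic.ne_zero
  have hcop : IsCoprime p₁ p₂ := by
    rw [isCoprime_iff_aeval_ne_zero_of_isAlgClosed ℝ ℂ]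
    intro z
    by_contra! h
    exact absurd (h1 z h.1) (not_lt.2 (h2 z h.2))
  have hcompl : IsCompl (aeval f p₁).ker (aeval f p₂).ker := by
    refine ⟨disjoint_ker_aeval_of_isCoprime f hcop, ?_⟩
    rw [codisjoint_iff, sup_ker_aeval_eq_ker_aeval_mul_of_coprime f hcop, ← hp,
      LinearMap.aeval_self_charpoly, LinearMap.ker_zero]
  have hmaps : ∀ p : ℝ[X], ∀ x ∈ (aeval f p).ker, f x ∈ (aeval f p).ker := by
    intro p x hx
    rw [LinearMap.mem_ker] at hx ⊢
    have : aeval f p * f = f * aeval f p := by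
      have := (Commute.all p X).map (aeval f)
      simpa using this.eq
    rw [← Module.End.mul_apply, this, Module.End.mul_apply, hx, map_zero]
  have hpart : ∀ p : ℝ[X], ∃ (d : ℕ) (M : Matrix (Fin d) (Fin d) ℝ)
      (e : (aeval f p).ker ≃ₗ[ℝ] (Fin d → ℝ)),
      (∀ x, e (f.restrict (hmaps p) x) = M *ᵥ (e x)) ∧ aeval M p = 0 := by
    intro p
    have b := Module.finBasis ℝ (aeval f p).ker
    refine ⟨_, LinearMap.toMatrix b b (f.restrict (hmaps p)), b.equivFun, fun x => ?_, ?_⟩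
    · exact (LinearMap.toMatrix_mulVec_repr b b _ x).symm
    · have h := aeval_algHom_apply (LinearMap.toMatrixAlgEquiv b).toAlgHom
        (f.restrict (hmaps p)) p
      have h0 : aeval (f.restrict (hmaps p)) p = 0 := by
        ext1 x
        apply Subtype.ext
        have : ((aeval (f.restrict (hmaps p)) p) x : Fin n → ℝ) = aeval f p x :=
          aeval_intertwine (aeval f p).ker.subtype (fun _ => rfl) p x
        rw [this]
        exact x.2
      rw [h0, map_zero] at h
      exact h
  obtain ⟨d₁, A₁, e₁, he₁, hA₁⟩ := hpart p₁
  obtain ⟨d₂, A₂, e₂, he₂, hA₂⟩ := hpart p₂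
  refine ⟨d₁, d₂, A₁, A₂,
    (Submodule.prodEquivOfIsCompl _ _ hcompl).symm.trans (e₁.prodCongr e₂), ?_, ?_, ?_⟩
  · intro x
    obtain ⟨y, rfl⟩ := (Submodule.prodEquivOfIsCompl _ _ hcompl).surjective x
    have : A *ᵥ (Submodule.prodEquivOfIsCompl _ _ hcompl y) =
        Submodule.prodEquivOfIsCompl _ _ hcompl
          (f.restrict (hmaps p₁) y.1, f.restrict (hmaps p₂) y.2) := by
      rw [← Matrix.toLin'_apply, ← hf]
      simp
    rw [this, LinearEquiv.trans_apply, LinearEquiv.trans_apply, LinearEquiv.symm_apply_apply,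
      LinearEquiv.symm_apply_apply]
    exact Prod.ext (he₁ y.1) (he₂ y.2)
  · exact fun μ hμ => h1 μ (aeval_eq_zero_of_mem_complexEigenvalues hμ hA₁)
  · exact fun μ hμ => h2 μ (aeval_eq_zero_of_mem_complexEigenvalues hμ hA₂)

theorem sum_logb_norm_complexEigenvalues {n : ℕ} (A : Matrix (Fin n) (Fin n) ℝ)
    (hA : ∀ μ ∈ complexEigenvalues A, μ ≠ 0) :
    ((complexEigenvalues A).map fun μ => Real.logb 2 ‖μ‖).sum = Real.logb 2 |A.det| := by
  have h1 : |A.det| = ((complexEigenvalues A).map fun μ => ‖μ‖).prod := by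
    have h2 : ((A.det : ℝ) : ℂ) = (complexEigenvalues A).prod := by
      rw [complexEigenvalues, ← Matrix.det_eq_prod_roots_charpoly]
      exact RingHom.map_det (algebraMap ℝ ℂ) A
    rw [← Real.norm_eq_abs, ← Complex.norm_real, h2]
    exact map_multiset_prod (normHom (α := ℂ)) _
  rw [h1]
  have h3 : ∀ s : Multiset ℂ, (∀ μ ∈ s, μ ≠ 0) →
      (s.map fun μ => Real.logb 2 ‖μ‖).sum = Real.logb 2 (s.map fun μ => ‖μ‖).prod := by
    intro s
    induction s using Multiset.induction_on with
    | empty => simp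
    | cons a s ih =>
      intro hs
      rw [Multiset.map_cons, Multiset.sum_cons, Multiset.map_cons, Multiset.prod_cons,
        Real.logb_mul, ih fun μ hμ => hs μ (Multiset.mem_cons_of_mem hμ)]
      · simpa using hs a (Multiset.mem_cons_self a s)
      · refine Multiset.prod_ne_zero ?_
        simp only [Multiset.mem_map, not_exists, not_and]
        exact fun μ hμ h => hs μ (Multiset.mem_cons_of_mem hμ) (norm_eq_zero.1 h)
  exact h3 _ hA

/-! ### Spectrum, determinant and powers under the splitting -/

namespace UnstableSplitting

variable {n d₁ d₂ : ℕ} {A : Matrix (Fin n) (Fin n) ℝ} {A₁ : Matrix (Fin d₁) (Fin d₁) ℝ}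
  {A₂ : Matrix (Fin d₂) (Fin d₂) ℝ} {e : (Fin n → ℝ) ≃ₗ[ℝ] (Fin d₁ → ℝ) × (Fin d₂ → ℝ)}

theorem complexEigenvalues_eq (h : UnstableSplitting A A₁ A₂ e) :
    complexEigenvalues A = complexEigenvalues A₁ + complexEigenvalues A₂ := by
  have h1 : e.conj (Matrix.toLin' A) = (Matrix.toLin' A₁).prodMap (Matrix.toLin' A₂) := by
    apply LinearMap.ext
    intro y
    rw [LinearEquiv.conj_apply_apply, Matrix.toLin'_apply, h.map_mulVec]
    simp
  have h2 : A.charpoly = A₁.charpoly * A₂.charpoly := by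
    have h3 := LinearEquiv.charpoly_conj e (Matrix.toLin' A)
    rw [h1, LinearMap.charpoly_prodMap] at h3
    simpa using h3.symm
  rw [complexEigenvalues, complexEigenvalues, complexEigenvalues, Matrix.charpoly_map,
    Matrix.charpoly_map, Matrix.charpoly_map, h2, Polynomial.map_mul, roots_mul]
  rw [← Matrix.charpoly_map, ← Matrix.charpoly_map]
  exact mul_ne_zero (Matrix.charpoly_monic _).ne_zero (Matrix.charpoly_monic _).ne_zero

theorem ne_zero (h : UnstableSplitting A A₁ A₂ e) : ∀ μ ∈ complexEigenvalues A₁, μ ≠ 0 := by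
  rintro μ hμ rfl
  have := h.unstable 0 hμ
  simp at this
  linarith

/-- Eigenvalues of `A₂` that pass the filter have modulus exactly 1 and contribute nothing. -/
theorem linearEntropy_eq (h : UnstableSplitting A A₁ A₂ e) :
    linearEntropy A = Real.logb 2 |A₁.det| := by
  rw [← sum_logb_norm_complexEigenvalues A₁ h.ne_zero, linearEntropy, h.complexEigenvalues_eq,
    Multiset.filter_add, Multiset.map_add, Multiset.sum_add,
    Multiset.filter_eq_self.2 fun μ hμ => (h.unstable μ hμ).le, add_eq_left]
  refine Multiset.sum_eq_zero fun x hx => ?_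
  obtain ⟨μ, hμ, rfl⟩ := Multiset.mem_map.1 hx
  rw [Multiset.mem_filter] at hμ
  rw [le_antisymm (h.stable μ hμ.1) hμ.2, Real.logb_one]

theorem det_ne_zero (h : UnstableSplitting A A₁ A₂ e) : A₁.det ≠ 0 := by
  intro h0
  have : (0 : ℂ) ∈ complexEigenvalues A₁ := by
    rw [mem_complexEigenvalues, ← coeff_zero_eq_aeval_zero', Matrix.det_eq_sign_charpoly_coeff] at *
    simp at h0
    simp [h0]
  exact h.ne_zero 0 this rfl

theorem map_pow_mulVec (h : UnstableSplitting A A₁ A₂ e) (k : ℕ) (x : Fin n → ℝ) :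
    e ((A ^ k) *ᵥ x) = ((A₁ ^ k) *ᵥ (e x).1, (A₂ ^ k) *ᵥ (e x).2) := by
  induction k with
  | zero => simp
  | succ k ih =>
    rw [pow_succ', ← Matrix.mulVec_mulVec, h.map_mulVec, ih]
    simp [pow_succ', Matrix.mulVec_mulVec]

/-- The inverse of the unstable part is Schur stable. -/
theorem norm_lt_one_of_mem_inv (h : UnstableSplitting A A₁ A₂ e) :
    ∀ μ ∈ complexEigenvalues A₁⁻¹, ‖μ‖ < 1 := by
  intro μ hμ
  let u : (Matrix (Fin d₁) (Fin d₁) ℝ)ˣ := A₁.nonsingInvUnit h.det_ne_zero.isUnit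
  let v : (Matrix (Fin d₁) (Fin d₁) ℂ)ˣ := Units.map (algebraMap ℝ ℂ).mapMatrix.toMonoidHom u
  have hμ1 : μ ∈ spectrum ℂ ((v⁻¹ : (Matrix (Fin d₁) (Fin d₁) ℂ)ˣ) : Matrix (Fin d₁) (Fin d₁) ℂ) :=
    Matrix.mem_spectrum_iff_isRoot_charpoly.2 (isRoot_of_mem_roots hμ)
  have hμ0 : μ ≠ 0 := spectrum.ne_zero_of_mem_of_unit hμ1
  have hμ2 : μ⁻¹ ∈ complexEigenvalues A₁ := by
    have := (spectrum.inv_mem_iff (r := Units.mk0 μ hμ0) (a := v⁻¹)).1 hμ1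
    rw [inv_inv] at this
    exact (mem_roots (Matrix.charpoly_monic _).ne_zero).2
      (Matrix.mem_spectrum_iff_isRoot_charpoly.1 this)
  have := h.unstable _ hμ2
  rw [norm_inv] at this
  exact (one_lt_inv₀ (norm_pos_iff.2 hμ0)).1 this

end UnstableSplitting

end

section

/-! ### Covering and packing -/

open MeasureTheory

theorem exists_norm_map_le {E F : Type*} [NormedAddCommGroup E] [NormedSpace ℝ E]
    [FiniteDimensional ℝ E] [NormedAddCommGroup F] [NormedSpace ℝ F] (f : E →ₗ[ℝ] F) :
    ∃ K : ℝ, 0 < K ∧ ∀ x, ‖f x‖ ≤ K * ‖x‖ :=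
  ⟨‖f.toContinuousLinearMap‖ + 1, by positivity, fun x =>
    (f.toContinuousLinearMap.le_opNorm x).trans (by gcongr; linarith)⟩

/-- A maximal separated finite set is a net. -/
theorem exists_finset_net {E : Type*} (T : Set E) (r : E → E → Prop) (hr : ∀ x, r x x)
    (hsymm : ∀ x y, r x y → r y x) (N : ℕ)
    (hN : ∀ S : Finset E, ↑S ⊆ T → (S : Set E).Pairwise (fun x y => ¬ r x y) → S.card ≤ N) :
    ∃ S : Finset E, ↑S ⊆ T ∧ (S : Set E).Pairwise (fun x y => ¬ r x y) ∧
      ∀ x ∈ T, ∃ s ∈ S, r x s := by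
  classical
  by_contra! h
  have key : ∀ k : ℕ, ∃ S : Finset E, ↑S ⊆ T ∧ (S : Set E).Pairwise (fun x y => ¬ r x y) ∧
      S.card = k := by
    intro k
    induction k with
    | zero => exact ⟨∅, by simp⟩
    | succ k ih =>
      obtain ⟨S, hST, hS, hk⟩ := ih
      obtain ⟨x, hxT, hx⟩ := h S hST hS
      have hxS : x ∉ S := fun hxS => hx x hxS (hr x)
      refine ⟨insert x S, ?_, ?_, by rw [Finset.card_insert_of_notMem hxS, hk]⟩
      · rw [Finset.coe_insert]
        exact Set.insert_subset hxT hST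
      · rw [Finset.coe_insert]
        refine hS.insert fun y hy _ => ⟨hx y hy, fun hyx => hx y hy (hsymm _ _ hyx)⟩
  obtain ⟨S, hST, hS, hk⟩ := key (N + 1)
  have := hN S hST hS
  omega

section Volume

variable {E : Type*} [NormedAddCommGroup E] [NormedSpace ℝ E] [MeasurableSpace E] [BorelSpace E]
  [FiniteDimensional ℝ E]

/-- The unit ball is covered by `O(|det L|⁻¹)` translates of the image of a ball under `L`,
uniformly for linear maps `L` of bounded norm. -/
theorem exists_covering_by_translates (μ : Measure E) [μ.IsAddHaarMeasure] (K ρ : ℝ)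
    (hK : 0 ≤ K) (hρ : 0 < ρ) :
    ∃ c : ℝ, 0 < c ∧ ∀ L : E →ₗ[ℝ] E, LinearMap.det L ≠ 0 → (∀ u, ‖L u‖ ≤ K * ‖u‖) →
      ∃ S : Finset E, (S.card : ℝ) ≤ c * |LinearMap.det L|⁻¹ ∧
        ∀ x, ‖x‖ ≤ 1 → ∃ s ∈ S, ∃ u, ‖u‖ ≤ ρ ∧ x - s = L u := by
  set v := μ.real (Metric.closedBall 0 (ρ / 2)) with hv
  set w := μ.real (Metric.closedBall 0 (1 + K * (ρ / 2))) with hw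
  have hv0 : 0 < v := ENNReal.toReal_pos (Metric.measure_closedBall_pos μ _ (by positivity)).ne'
    measure_closedBall_lt_top.ne
  have hw0 : 0 < w := ENNReal.toReal_pos (Metric.measure_closedBall_pos μ _ (by positivity)).ne'
    measure_closedBall_lt_top.ne
  refine ⟨w / v, by positivity, fun L hL hLK => ?_⟩
  have hdet : 0 < |LinearMap.det L| := abs_pos.2 hL
  have hcard : ∀ S : Finset E, (S : Set E) ⊆ Metric.closedBall 0 1 →
      (S : Set E).Pairwise (fun x y => ¬ ∃ u, ‖u‖ ≤ ρ ∧ x - y = L u) →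
      (S.card : ℝ) ≤ w / v * |LinearMap.det L|⁻¹ := by
    intro S hS1 hS2
    have hcompact : IsCompact (L '' Metric.closedBall 0 (ρ / 2)) :=
      (isCompact_closedBall _ _).image L.continuous_of_finiteDimensional
    have himage : ∀ s : E, IsCompact ((fun y => s + y) '' (L '' Metric.closedBall 0 (ρ / 2))) :=
      fun s => hcompact.image (by fun_prop)
    have hmeas : ∀ s : E, μ.real ((fun y => s + y) '' (L '' Metric.closedBall 0 (ρ / 2))) =
        |LinearMap.det L| * v := by
      intro s
      rw [Measure.real, Set.image_add_left, measure_preimage_add, Measure.addHaar_image_linearMap,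
        ENNReal.toReal_mul, ENNReal.toReal_ofReal hdet.le]
      rfl
    have hsum : μ.real (⋃ s ∈ S, (fun y => s + y) '' (L '' Metric.closedBall 0 (ρ / 2))) =
        S.card * (|LinearMap.det L| * v) := by
      rw [measureReal_biUnion_finset (h := fun s _ => (himage s).measure_lt_top.ne),
        Finset.sum_congr rfl fun s _ => hmeas s, Finset.sum_const,
        nsmul_eq_mul]
      · rintro s hs s' hs' hne
        -- A common point of the two half-size sets would give `s - s' = L (b - a)` with `‖b - a‖ ≤
        -- ρ`.
        refine Set.disjoint_left.2 ?_
        rintro _ ⟨_, ⟨a, ha, rfl⟩, rfl⟩ ⟨_, ⟨b, hb, rfl⟩, h⟩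
        refine hS2 hs hs' hne ⟨b - a, ?_, ?_⟩
        · rw [mem_closedBall_zero_iff] at ha hb
          linarith [norm_sub_le b a]
        · simp only at h
          rw [map_sub, sub_eq_sub_iff_add_eq_add, ← h, add_comm]
      · exact fun s _ => (himage s).measurableSet
    have hle : (S.card : ℝ) * (|LinearMap.det L| * v) ≤ w := by
      rw [← hsum]
      refine measureReal_mono ?_ measure_closedBall_lt_top.ne
      refine Set.iUnion₂_subset fun s hs => ?_
      rintro _ ⟨_, ⟨a, ha, rfl⟩, rfl⟩
      have h1 := hS1 hs
      rw [mem_closedBall_zero_iff] at ha h1 ⊢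
      calc ‖s + L a‖ ≤ ‖s‖ + ‖L a‖ := norm_add_le _ _
        _ ≤ 1 + K * (ρ / 2) := add_le_add h1 ((hLK a).trans (by gcongr))
    rw [← div_eq_mul_inv, div_div, le_div_iff₀ (by positivity)]
    linarith
  obtain ⟨S, hS1, hS2, hS3⟩ := exists_finset_net (Metric.closedBall (0 : E) 1)
    (fun x y => ∃ u, ‖u‖ ≤ ρ ∧ x - y = L u) (fun x => ⟨0, by simp [hρ.le]⟩)
    (fun x y ⟨u, hu, h⟩ => ⟨-u, by simpa using hu, by rw [map_neg, ← h, neg_sub]⟩)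
    ⌊w / v * |LinearMap.det L|⁻¹⌋₊ (fun S h1 h2 => Nat.le_floor (hcard S h1 h2))
  exact ⟨S, hcard S hS1 hS2, fun x hx => hS3 x (mem_closedBall_zero_iff.2 hx)⟩

/-- If sets of points in a ball that are separated after an application of `L` have at most `N`
elements, then `N` is at least of the order of `|det L|`. -/
theorem measure_closedBall_mul_det_le (μ : Measure E) [μ.IsAddHaarMeasure]
    (L : E →ₗ[ℝ] E) (hL : LinearMap.det L ≠ 0) {l R : ℝ}
    (hR : 0 ≤ R) (N : ℕ)
    (hN : ∀ S : Finset E, (S : Set E) ⊆ Metric.closedBall 0 l →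
      (S : Set E).Pairwise (fun x y => ¬ ‖L (x - y)‖ ≤ R) → S.card ≤ N) :
    μ.real (Metric.closedBall 0 l) * |LinearMap.det L| ≤
      N * μ.real (Metric.closedBall 0 R) := by
  have hdet : 0 < |LinearMap.det L| := abs_pos.2 hL
  -- By maximality the sets `L ⁻¹' closedBall (L s) R` cover the ball of radius `l`; each has volume
  -- `|det L|⁻¹` times that of an `R`-ball.
  obtain ⟨S, hS1, hS2, hS3⟩ := exists_finset_net (Metric.closedBall (0 : E) l)
    (fun x y => ‖L (x - y)‖ ≤ R) (fun x => by simpa using hR)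
    (fun x y h => by rwa [← neg_sub, map_neg, norm_neg]) N hN
  have hmeas : ∀ s, μ (L ⁻¹' Metric.closedBall (L s) R) =
      ENNReal.ofReal |(LinearMap.det L)⁻¹| * μ (Metric.closedBall 0 R) := by
    intro s
    rw [Measure.addHaar_preimage_linearMap μ hL, Measure.addHaar_closedBall_center]
  have hfin : ∀ s, μ (L ⁻¹' Metric.closedBall (L s) R) ≠ ⊤ := fun s => by
    rw [hmeas]
    exact ENNReal.mul_ne_top ENNReal.ofReal_ne_top measure_closedBall_lt_top.ne
  have h1 : μ.real (Metric.closedBall 0 l) ≤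
      S.card * (|LinearMap.det L|⁻¹ * μ.real (Metric.closedBall 0 R)) := by
    calc μ.real (Metric.closedBall 0 l)
        ≤ μ.real (⋃ s ∈ S, L ⁻¹' Metric.closedBall (L s) R) := by
          refine measureReal_mono (fun x hx => ?_) ?_
          · obtain ⟨s, hs, h⟩ := hS3 x hx
            refine Set.mem_iUnion₂.2 ⟨s, hs, ?_⟩
            rwa [Set.mem_preimage, mem_closedBall_iff_norm, ← map_sub]
          · exact ((measure_biUnion_finset_le S _).trans_lt
              (ENNReal.sum_lt_top.2 fun s _ => (hfin s).lt_top)).ne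
      _ ≤ ∑ s ∈ S, μ.real (L ⁻¹' Metric.closedBall (L s) R) :=
          measureReal_biUnion_finset_le _ _
      _ = _ := by
          rw [← nsmul_eq_mul, ← Finset.sum_const]
          refine Finset.sum_congr rfl fun s _ => ?_
          rw [Measure.real, hmeas, ENNReal.toReal_mul, ENNReal.toReal_ofReal (abs_nonneg _),
            abs_inv]
          rfl
  calc μ.real (Metric.closedBall 0 l) * |LinearMap.det L|
      ≤ S.card * (|LinearMap.det L|⁻¹ * μ.real (Metric.closedBall 0 R)) * |LinearMap.det L| := by
        gcongr
    _ = S.card * μ.real (Metric.closedBall 0 R) := by field_simp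
    _ ≤ N * μ.real (Metric.closedBall 0 R) := by
        gcongr
        exact hN S hS1 hS2

end Volume

/-! ### Quantization at the rate of the linear entropy -/

theorem two_rpow_linearEntropy_mul {n d₁ d₂ : ℕ} {A : Matrix (Fin n) (Fin n) ℝ}
    {A₁ : Matrix (Fin d₁) (Fin d₁) ℝ} {A₂ : Matrix (Fin d₂) (Fin d₂) ℝ}
    {e : (Fin n → ℝ) ≃ₗ[ℝ] (Fin d₁ → ℝ) × (Fin d₂ → ℝ)} (h : UnstableSplitting A A₁ A₂ e) (k : ℕ) :
    (2 : ℝ) ^ (k * linearEntropy A) = |A₁.det| ^ k := by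
  rw [mul_comm, Real.rpow_mul (by norm_num), h.linearEntropy_eq,
    Real.rpow_logb (by norm_num) (by norm_num) (abs_pos.2 h.det_ne_zero), Real.rpow_natCast]

/-- For large `k` the unit ball is covered by `2 ^ (k * h)` sets which `A ^ k` maps into balls of
radius `1 / 2`, whenever `h` exceeds the entropy of `A`. -/
theorem eventually_exists_covering {n : ℕ} (A : Matrix (Fin n) (Fin n) ℝ) {h : ℝ}
    (hh : linearEntropy A < h) :
    ∀ᶠ k : ℕ in Filter.atTop, ∃ S : Finset (Fin n → ℝ), (S.card : ℝ) ≤ 2 ^ (k * h) ∧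
      ∀ x, ‖x‖ ≤ 1 → ∃ s ∈ S, ‖(A ^ k) *ᵥ (x - s)‖ ≤ 1 / 2 := by
  obtain ⟨d₁, d₂, A₁, A₂, e, hs⟩ := exists_unstableSplitting A
  -- The slack in `h` is halved: one half pays for `r ^ (k * d₂)`, the other for the constant `c`
  -- when `k` is large.
  set δ := (h - linearEntropy A) / (2 * (d₂ + 1)) with hδ
  have hδ0 : 0 < δ := div_pos (by linarith) (by positivity)
  set r : ℝ := 2 ^ δ with hr
  have hr1 : 1 < r := Real.one_lt_rpow (by norm_num) hδ0
  obtain ⟨C₁, t₁, hC₁, ht₁, ht₁', h1⟩ :=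
    exists_norm_pow_mulVec_le A₁⁻¹ one_pos hs.norm_lt_one_of_mem_inv
  obtain ⟨C₂, t₂, hC₂, ht₂, ht₂', h2⟩ :=
    exists_norm_pow_mulVec_le A₂ (one_pos.trans hr1) (fun μ hμ => (hs.stable μ hμ).trans_lt hr1)
  obtain ⟨Ke, hKe0, hKe⟩ := exists_norm_map_le e.toLinearMap
  obtain ⟨Ks, hKs0, hKs⟩ := exists_norm_map_le e.symm.toLinearMap
  simp only [LinearEquiv.coe_coe] at hKe hKs
  set C := max (max C₁ C₂) 1
  have hC1 : C₁ ≤ C := (le_max_left _ _).trans (le_max_left _ _)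
  have hC2 : C₂ ≤ C := (le_max_right _ _).trans (le_max_left _ _)
  have hC3 : 1 ≤ C := le_max_right _ _
  have hC0 : 0 < C := one_pos.trans_le hC3
  set K := Ks * C * Ke with hK
  have hK0 : 0 < K := by positivity
  obtain ⟨c, hc0, hc⟩ := exists_covering_by_translates (volume : Measure (Fin n → ℝ)) K
    (1 / (2 * K)) hK0.le (by positivity)
  have hev : ∀ᶠ k : ℕ in Filter.atTop, c ≤ 2 ^ (k * ((h - linearEntropy A) / 2)) := by
    have : Filter.Tendsto (fun k : ℕ => ((2 : ℝ) ^ ((h - linearEntropy A) / 2)) ^ k) Filter.atTop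
        Filter.atTop :=
      tendsto_pow_atTop_atTop_of_one_lt (Real.one_lt_rpow (by norm_num) (by linarith))
    filter_upwards [this.eventually_ge_atTop c] with k hk
    rwa [mul_comm, Real.rpow_mul (by norm_num), Real.rpow_natCast]
  filter_upwards [hev] with k hk
  -- The shape of a cell: `A₁ ^ k` undoes the first block exactly, and `r ^ (-k)` outweighs the
  -- growth of `A₂ ^ k` because `t₂ < r`. So both `D` and `A ^ k` after `D` are bounded uniformly in
  -- `k`, up to coordinates.
  let D : (Fin d₁ → ℝ) × (Fin d₂ → ℝ) →ₗ[ℝ] (Fin d₁ → ℝ) × (Fin d₂ → ℝ) :=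
    (Matrix.toLin' (A₁⁻¹ ^ k)).prodMap ((r⁻¹ ^ k) • LinearMap.id)
  have hr0 : 0 < r := one_pos.trans hr1
  have hdet : |LinearMap.det (e.symm.conj D)|⁻¹ = |A₁.det| ^ k * (r ^ k) ^ d₂ := by
    rw [show LinearMap.det (e.symm.conj D) = LinearMap.det D from LinearMap.det_conj D e.symm,
      LinearMap.det_prodMap, LinearMap.det_toLin', Matrix.det_pow, LinearMap.det_smul,
      LinearMap.det_id, Module.finrank_fin_fun, Matrix.det_nonsing_inv, Ring.inverse_eq_inv']
    rw [abs_mul, abs_pow, abs_inv, mul_one, abs_of_pos (by positivity : 0 < (r⁻¹ ^ k) ^ d₂)]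
    simp [mul_comm]
  have hdet0 : LinearMap.det (e.symm.conj D) ≠ 0 := by
    intro h0
    rw [h0, abs_zero, inv_zero] at hdet
    have : 0 < |A₁.det| ^ k * (r ^ k) ^ d₂ :=
      mul_pos (pow_pos (abs_pos.2 hs.det_ne_zero) _) (by positivity)
    linarith
  have hbound : ∀ (w : (Fin n → ℝ)) (y), (‖y‖ ≤ C * ‖e w‖) → ‖e.symm y‖ ≤ K * ‖w‖ := by
    intro w y hy
    calc ‖e.symm y‖ ≤ Ks * (C * (Ke * ‖w‖)) := 
        (hKs y).trans (by gcongr; exact hy.trans (by gcongr; exact hKe w))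
      _ = K * ‖w‖ := by rw [hK]; ring
  obtain ⟨S, hS1, hS2⟩ := hc (e.symm.conj D) hdet0 (fun u => by
    rw [LinearEquiv.conj_apply_apply, LinearEquiv.symm_symm]
    refine hbound u _ (max_le ?_ ?_)
    · have : ‖(A₁⁻¹ ^ k) *ᵥ (e u).1‖ ≤ C * ‖e u‖ := by
        refine (h1 k _).trans ?_
        have := pow_le_one₀ ht₁.le ht₁'.le (n := k)
        calc C₁ * t₁ ^ k * ‖(e u).1‖ ≤ C * 1 * ‖e u‖ := by gcongr; exact norm_fst_le _
          _ = _ := by ring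
      simpa [D] using this
    · have : ‖(r⁻¹ ^ k) • (e u).2‖ ≤ C * ‖e u‖ := by
        rw [norm_smul, Real.norm_of_nonneg (by positivity)]
        have := pow_le_one₀ (inv_nonneg.2 hr0.le) (inv_le_one_of_one_le₀ hr1.le) (n := k)
        gcongr
        · exact this.trans hC3
        · exact norm_snd_le _
      simpa [D] using this)
  refine ⟨S, hS1.trans ?_, fun x hx => ?_⟩
  · have hd : (d₂ : ℝ) * δ ≤ (h - linearEntropy A) / 2 := by
      rw [hδ, ← mul_div_assoc, div_le_div_iff₀ (by positivity) (by norm_num)]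
      nlinarith
    rw [hdet, ← two_rpow_linearEntropy_mul hs k]
    have hrk : (r ^ k) ^ d₂ = 2 ^ (k * (d₂ * δ)) := by
      rw [hr, ← Real.rpow_natCast, ← Real.rpow_natCast, ← Real.rpow_mul (by positivity),
        ← Real.rpow_mul (by norm_num)]
      congr 1
      ring
    rw [hrk]
    calc c * (2 ^ (k * linearEntropy A) * 2 ^ (k * (d₂ * δ)))
        ≤ 2 ^ (k * ((h - linearEntropy A) / 2)) * (2 ^ (k * linearEntropy A) *
          2 ^ (k * ((h - linearEntropy A) / 2))) := by
          gcongr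
          norm_num
      _ = 2 ^ (k * h) := by
          rw [← Real.rpow_add (by norm_num), ← Real.rpow_add (by norm_num)]
          congr 1
          ring
  · obtain ⟨s, hsS, u, hu, hxs⟩ := hS2 x hx
    refine ⟨s, hsS, ?_⟩
    have h3 : (A ^ k) *ᵥ (x - s) = e.symm ((e u).1, (A₂ ^ k) *ᵥ ((r⁻¹ ^ k) • (e u).2)) := by
      rw [LinearEquiv.eq_symm_apply, hs.map_pow_mulVec, hxs, LinearEquiv.conj_apply_apply]
      have h4 : A₁ ^ k * (A₁ ^ k)⁻¹ = 1 :=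
        Matrix.mul_nonsing_inv _ (by rw [Matrix.det_pow]; exact hs.det_ne_zero.isUnit.pow k)
      simp [D, Matrix.mulVec_mulVec, h4]
    rw [h3]
    refine (hbound u _ (max_le ?_ ?_)).trans ?_
    · calc ‖(e u).1‖ ≤ 1 * ‖e u‖ := by rw [one_mul]; exact norm_fst_le _
        _ ≤ C * ‖e u‖ := by gcongr
    · refine (h2 k _).trans ?_
      rw [norm_smul, Real.norm_of_nonneg (by positivity)]
      have : t₂ ^ k * r⁻¹ ^ k ≤ 1 := by
        rw [← mul_pow]
        refine pow_le_one₀ (by positivity) ?_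
        rw [← div_eq_mul_inv, div_le_one hr0]
        exact ht₂'.le
      calc C₂ * t₂ ^ k * (r⁻¹ ^ k * ‖(e u).2‖) = C₂ * (t₂ ^ k * r⁻¹ ^ k) * ‖(e u).2‖ := by ring
        _ ≤ C * 1 * ‖e u‖ := by gcongr; exact norm_snd_le _
        _ = C * ‖e u‖ := by ring
    · calc K * ‖u‖ ≤ K * (1 / (2 * K)) := by gcongr
        _ = 1 / 2 := by field_simp

end

/-! ### Necessity -/

section Necessity

open MeasureTheory

variable {q nx nu : ℕ} {Ω : Type*} {A : Matrix (Fin nx) (Fin nx) ℝ}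
  {B : Matrix (Fin nx) (Fin nu) ℝ} {c : CoderController q nx nu}
  {V : Ω → ℕ → (Fin nx → ℝ)} {Z : Ω → ℕ → ZMod q} {X : Ω → ℕ → (Fin nx → ℝ)} {Y : Ω → ℕ → ZMod q}

/-- Equal outputs produce equal controls, which cancel in the difference. -/
theorem IsClosedLoop.sub_eq_pow_mulVec (h : IsClosedLoop A B c V Z X Y) {π π' : Ω}
    (hV : ∀ t, V π t = V π' t) {k : ℕ} (hY : ∀ i < k, Y π i = Y π' i) :
    X π k - X π' k = (A ^ k) *ᵥ (X π 0 - X π' 0) := by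
  induction k with
  | zero => simp
  | succ k ih =>
    have hy : (fun i : Fin (k + 1) => Y π i) = fun i : Fin (k + 1) => Y π' i :=
      funext fun i => hY i i.2
    rw [h.plant, h.plant, hy, hV, pow_succ', ← Matrix.mulVec_mulVec,
      ← ih fun i hi => hY i (hi.trans k.lt_succ_self), Matrix.mulVec_sub]
    abel

theorem IsClosedLoop.noise_eq (h : IsClosedLoop A B c V Z X Y) {π π' : Ω}
    (hV : ∀ t, V π t = V π' t) (hX : X π 0 = X π' 0) {k : ℕ} (hY : ∀ i < k, Y π i = Y π' i) :
    ∀ i < k, Z π i = Z π' i := by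
  intro i hi
  have hx : (fun j : Fin (i + 1) => X π j) = fun j : Fin (i + 1) => X π' j := by
    ext1 j
    have := h.sub_eq_pow_mulVec hV (k := j) fun r hr => hY r (by omega)
    rwa [hX, sub_self, Matrix.mulVec_zero, sub_eq_zero] at this
  have h1 := h.channel π i
  rw [hx, hY i hi, h.channel π' i] at h1
  exact (add_left_cancel h1).symm

/-- The initial states that the controller has to tell apart, together with the noise words, are
encoded injectively in the channel outputs. -/
theorem IsClosedLoop.card_mul_ncard_le [NeZero q] {σ : Type*} {N : NoiseMachine q σ}
    (h : IsClosedLoop A B c V Z X Y) {T : Type*} (S : Finset T) (x : T → Fin nx → ℝ) (k : ℕ)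
    {R : ℝ} (hR : ∀ π, ‖X π k‖ ≤ R) {v : ℕ → Fin nx → ℝ}
    (hreal : ∀ s ∈ S, ∀ z ∈ N.noiseSequences, ∃ π, X π 0 = x s ∧ V π = v ∧ Z π = z)
    (hS : (S : Set T).Pairwise fun s s' => ¬ ‖(A ^ k) *ᵥ (x s - x s')‖ ≤ 2 * R) :
    S.card * (N.noiseWords k).ncard ≤ q ^ k := by
  have hex : ∀ p : S × N.noiseWords k, ∃ π, X π 0 = x p.1 ∧ V π = v ∧
      ∀ i : Fin k, p.2.1 i = Z π i := by
    rintro ⟨⟨s, hs⟩, ⟨w, z, hz, hw⟩⟩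
    obtain ⟨π, h1, h2, h3⟩ := hreal s hs z hz
    exact ⟨π, h1, h2, fun i => h3 ▸ hw i⟩
  choose π hπX hπV hπZ using hex
  have hinj : Function.Injective fun p => fun i : Fin k => Y (π p) i := by
    intro p p' hpp
    have hY : ∀ i < k, Y (π p) i = Y (π p') i := fun i hi => congrFun hpp ⟨i, hi⟩
    have hV : ∀ t, V (π p) t = V (π p') t := fun t => by rw [hπV, hπV]
    have hs : p.1 = p'.1 := by
      -- With equal outputs, the two states at time `k` would differ by more than `2 * R`.
      by_contra hne
      refine hS p.1.2 p'.1.2 (fun h => hne (Subtype.ext h)) ?_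
      rw [← hπX, ← hπX, ← h.sub_eq_pow_mulVec hV hY]
      linarith [norm_sub_le (X (π p) k) (X (π p') k), hR (π p), hR (π p')]
    refine Prod.ext hs (Subtype.ext (funext fun i => ?_))
    rw [hπZ, hπZ]
    exact h.noise_eq hV (by rw [hπX, hπX, hs]) hY i i.2
  have := Nat.card_le_card_of_injective _ hinj
  rw [Nat.card_prod, Nat.card_eq_fintype_card, Fintype.card_coe, Nat.card_coe_set_eq,
    Nat.card_fun, Nat.card_zmod, Nat.card_fin] at this
  exact this

/-- Unrelatedness allows an arbitrary combination of initial state, zero plant noise and channel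
noise. -/
theorem UncertaintyAssumptions.exists_realization {σ : Type*} {N : NoiseMachine q σ} {Dx D : ℝ}
    (h : UncertaintyAssumptions N Dx D (fun π => X π 0) V Z) {x : Fin nx → ℝ}
    (hx : x ∈ Set.range fun π => X π 0) {z : ℕ → ZMod q} (hz : z ∈ N.noiseSequences) :
    ∃ π, X π 0 = x ∧ V π = 0 ∧ Z π = z := by
  obtain ⟨π₀, hπ₀⟩ := h.zero_noise
  have hmem : (x, V π₀, z) ∈ Set.range (fun π => X π 0) ×ˢ Set.range V ×ˢ Set.range Z :=
    ⟨hx, ⟨π₀, rfl⟩, h.channel_noise ▸ hz⟩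
  rw [← h.unrelated] at hmem
  obtain ⟨π, hπ⟩ := hmem
  simp only [Prod.mk.injEq] at hπ
  exact ⟨π, hπ.1, hπ.2.1.trans (funext hπ₀), hπ.2.2⟩

theorem entropy_add_le_of_uniformlyBounded [NeZero q] {σ : Type*} [Finite σ] [Nonempty σ]
    {N : NoiseMachine q σ} {Dx D : ℝ}
    (hU : UncertaintyAssumptions N Dx D (fun π => X π 0) V Z)
    (hl : ∃ l > 0, Metric.closedBall 0 l ⊆ Set.range (fun π => X π 0))
    (hloop : IsClosedLoop A B c V Z X Y) (hb : UniformlyBounded X) :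
    linearEntropy A + N.entropy ≤ Real.logb 2 q := by
  obtain ⟨R, hR⟩ := hb
  obtain ⟨l, hl0, hl⟩ := hl
  have hR0 : 0 ≤ R := by
    obtain ⟨π, -⟩ := hU.zero_noise
    exact (norm_nonneg _).trans (hR π 0)
  obtain ⟨d₁, d₂, A₁, A₂, e, hs⟩ := exists_unstableSplitting A
  obtain ⟨Ke, hKe0, hKe⟩ := exists_norm_map_le e.toLinearMap
  obtain ⟨Ks, hKs0, hKs⟩ := exists_norm_map_le e.symm.toLinearMap
  simp only [LinearEquiv.coe_coe] at hKe hKs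
  set a := volume.real (Metric.closedBall (0 : Fin d₁ → ℝ) (l / Ks))
  have ha : 0 < a := ENNReal.toReal_pos
    (Metric.measure_closedBall_pos volume _ (by positivity)).ne' measure_closedBall_lt_top.ne
  set b := volume.real (Metric.closedBall (0 : Fin d₁ → ℝ) (Ke * (2 * R)))
  have hcount : ∀ k : ℕ, a * 2 ^ (k * linearEntropy A) * (N.stateSequences k).ncard ≤
      b * Nat.card σ * q ^ k := by
    intro k
    have hw : 0 < (N.noiseWords k).ncard := by
      obtain ⟨s, hs⟩ := N.stateSequences_nonempty k
      exact (Set.ncard_pos (Set.toFinite _)).2 ⟨_, N.walkLabels_mem_noiseWords hs⟩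
    -- Only initial states in the unstable subspace are tested. Radius `l / Ks` keeps them in the
    -- given ball, and `Ke * (2 * R)` transfers separation to the original coordinates.
    have hvol := measure_closedBall_mul_det_le (volume : Measure (Fin d₁ → ℝ))
      (Matrix.toLin' (A₁ ^ k)) (by
        rw [LinearMap.det_toLin', Matrix.det_pow]; exact pow_ne_zero _ hs.det_ne_zero)
      (l := l / Ks) (R := Ke * (2 * R)) (by positivity) (q ^ k / (N.noiseWords k).ncard) (by
        intro S hSl hS
        rw [Nat.le_div_iff_mul_le hw]
        refine hloop.card_mul_ncard_le S (fun s => e.symm (s, 0)) k (fun π => hR π k)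
          (fun s hs z hz => hU.exists_realization (hl ?_) hz) ?_
        · have := hSl hs
          rw [mem_closedBall_zero_iff, le_div_iff₀ hKs0] at this
          rw [mem_closedBall_zero_iff]
          refine (hKs _).trans ?_
          rw [Prod.norm_mk, norm_zero, max_eq_left (norm_nonneg _)]
          linarith
        · intro s hs1 s' hs2 hne hle
          refine hS hs1 hs2 hne ?_
          have h1 := hs.map_pow_mulVec k (e.symm (s, 0) - e.symm (s', 0))
          have h2 : (A₁ ^ k) *ᵥ (s - s') =
              (e ((A ^ k) *ᵥ (e.symm (s, 0) - e.symm (s', 0)))).1 := by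
            rw [h1]
            simp
          rw [Matrix.toLin'_apply, h2]
          refine (norm_fst_le _).trans ((hKe _).trans ?_)
          gcongr)
    rw [LinearMap.det_toLin', Matrix.det_pow, abs_pow, ← two_rpow_linearEntropy_mul hs] at hvol
    have h1 : ((N.stateSequences k).ncard : ℝ) ≤ Nat.card σ * (N.noiseWords k).ncard := by
      exact_mod_cast N.ncard_stateSequences_le_mul k
    have h2 : ((q ^ k / (N.noiseWords k).ncard : ℕ) : ℝ) * (N.noiseWords k).ncard ≤ q ^ k := by
      exact_mod_cast Nat.div_mul_le_self _ _
    have hb0 : 0 ≤ b := measureReal_nonneg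
    calc a * 2 ^ (k * linearEntropy A) * (N.stateSequences k).ncard
        ≤ ((q ^ k / (N.noiseWords k).ncard : ℕ) * b) * (Nat.card σ * (N.noiseWords k).ncard) := by
          gcongr
      _ = b * Nat.card σ * ((q ^ k / (N.noiseWords k).ncard : ℕ) * (N.noiseWords k).ncard) := by
          ring
      _ ≤ b * Nat.card σ * q ^ k := by gcongr
  by_contra! hlt
  obtain ⟨h, hh1, hh2⟩ := exists_between (sub_lt_iff_lt_add'.2 hlt)
  have hq : (0 : ℝ) < q := by exact_mod_cast NeZero.pos q
  have hgrow : Filter.Tendsto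
      (fun k : ℕ => ((2 : ℝ) ^ (linearEntropy A + h - Real.logb 2 q)) ^ k) Filter.atTop
      Filter.atTop :=
    tendsto_pow_atTop_atTop_of_one_lt (Real.one_lt_rpow (by norm_num) (by linarith))
  -- One length that has many walks and at which the exponential excess beats the constants of
  -- `hcount`.
  obtain ⟨k, hk1, hk2⟩ := ((N.frequently_lt_logb_of_lt_entropy hh2).and_eventually
    (hgrow.eventually_gt_atTop (b * Nat.card σ / a))).exists
  have h3 : (2 : ℝ) ^ (k * h) ≤ (N.stateSequences k).ncard := by
    rwa [← Real.le_logb_iff_rpow_le (by norm_num)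
      (one_pos.trans_le (N.one_le_ncard_stateSequences k))]
  have h4 : ((2 : ℝ) ^ (linearEntropy A + h - Real.logb 2 q)) ^ k * q ^ k =
      2 ^ (k * linearEntropy A) * 2 ^ (k * h) := by
    rw [← mul_pow, Real.rpow_sub (by norm_num), Real.rpow_logb (by norm_num) (by norm_num) hq,
      div_mul_cancel₀ _ hq.ne', ← Real.rpow_natCast, ← Real.rpow_mul (by norm_num),
      ← Real.rpow_add (by norm_num)]
    congr 1
    ring
  rw [div_lt_iff₀ ha] at hk2
  have h5 : b * Nat.card σ * q ^ k < a * 2 ^ (k * linearEntropy A) * (N.stateSequences k).ncard := by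
    calc b * Nat.card σ * (q : ℝ) ^ k
        < ((2 : ℝ) ^ (linearEntropy A + h - Real.logb 2 q)) ^ k * a * q ^ k := by gcongr
      _ = a * (((2 : ℝ) ^ (linearEntropy A + h - Real.logb 2 q)) ^ k * q ^ k) := by ring
      _ = a * 2 ^ (k * linearEntropy A) * 2 ^ (k * h) := by rw [h4]; ring
      _ ≤ _ := by gcongr
  exact absurd (hcount k) (not_le.2 h5)

end Necessity

/-! ### Perturbed linear systems -/

theorem eq_pow_mulVec_add_sum {d : ℕ} {M : Matrix (Fin d) (Fin d) ℝ} {x w : ℕ → Fin d → ℝ}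
    (h : ∀ t, x (t + 1) = M *ᵥ x t + w t) (t : ℕ) :
    x t = (M ^ t) *ᵥ x 0 + ∑ i ∈ Finset.range t, (M ^ i) *ᵥ w (t - 1 - i) := by
  induction t with
  | zero => simp
  | succ t ih =>
    have hsum : M *ᵥ (∑ i ∈ Finset.range t, (M ^ i) *ᵥ w (t - 1 - i)) =
        ∑ i ∈ Finset.range t, M *ᵥ ((M ^ i) *ᵥ w (t - 1 - i)) := map_sum M.mulVecLin _ _
    rw [h, Finset.sum_range_succ', ih, Matrix.mulVec_add, Matrix.mulVec_mulVec, ← pow_succ',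
      hsum, pow_zero, Matrix.one_mulVec, add_assoc]
    congr 2
    refine Finset.sum_congr rfl fun i _ => ?_
    rw [Matrix.mulVec_mulVec, ← pow_succ']
    congr 2
    omega

/-- A Schur stable system driven by a bounded input is bounded. -/
theorem norm_le_of_schur_stable {d : ℕ} {M : Matrix (Fin d) (Fin d) ℝ} {C s : ℝ} (hC : 0 < C)
    (hs0 : 0 < s) (hs1 : s < 1) (hM : ∀ (n : ℕ) (x : Fin d → ℝ), ‖(M ^ n) *ᵥ x‖ ≤ C * s ^ n * ‖x‖)
    {x w : ℕ → Fin d → ℝ} (h : ∀ t, x (t + 1) = M *ᵥ x t + w t) {W : ℝ} (hw : ∀ t, ‖w t‖ ≤ W)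
    (t : ℕ) : ‖x t‖ ≤ C * ‖x 0‖ + C * W * (1 - s)⁻¹ := by
  have hW : 0 ≤ W := (norm_nonneg _).trans (hw 0)
  rw [eq_pow_mulVec_add_sum h t]
  refine (norm_add_le _ _).trans (add_le_add ?_ ?_)
  · refine (hM t _).trans ?_
    have := pow_le_one₀ hs0.le hs1.le (n := t)
    calc C * s ^ t * ‖x 0‖ ≤ C * 1 * ‖x 0‖ := by gcongr
      _ = _ := by ring
  · calc ‖∑ i ∈ Finset.range t, (M ^ i) *ᵥ w (t - 1 - i)‖
        ≤ ∑ i ∈ Finset.range t, C * W * s ^ i := by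
          refine norm_sum_le_of_le _ fun i _ => (hM i _).trans ?_
          calc C * s ^ i * ‖w (t - 1 - i)‖ ≤ C * s ^ i * W := by gcongr; exact hw _
            _ = _ := by ring
      _ = C * W * ∑ i ∈ Finset.range t, s ^ i := by rw [Finset.mul_sum]
      _ ≤ C * W * (1 - s)⁻¹ := by
          gcongr
          rw [← tsum_geometric_of_lt_one hs0.le hs1]
          exact (summable_geometric_of_lt_one hs0.le hs1).sum_le_tsum _
            fun i _ => by positivity

/-- Bounds over one block that are uniform in the trajectory: `E` for the accumulated noise, `P` for
the growth in between. -/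
theorem exists_norm_sub_pow_mulVec_le {d : ℕ} (A : Matrix (Fin d) (Fin d) ℝ) (D : ℝ) (n : ℕ) :
    ∃ E P : ℝ, 0 ≤ E ∧ 0 ≤ P ∧ ∀ x w : ℕ → Fin d → ℝ,
      (∀ i < n, x (i + 1) = A *ᵥ x i + w i) → (∀ i, ‖w i‖ ≤ D) →
      ∀ i ≤ n, ‖x i - (A ^ i) *ᵥ x 0‖ ≤ E ∧ ‖x i‖ ≤ P * ‖x 0‖ + E := by
  obtain ⟨a, ha, hA⟩ := exists_norm_map_le (Matrix.toLin' A)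
  simp only [Matrix.toLin'_apply] at hA
  induction n with
  | zero =>
    refine ⟨0, 1, le_rfl, zero_le_one, fun x w _ _ i hi => ?_⟩
    obtain rfl : i = 0 := by omega
    simp
  | succ n ih =>
    obtain ⟨E, P, hE, hP, h⟩ := ih
    refine ⟨max E (a * E + D), max P (a * P), le_max_of_le_left hE, le_max_of_le_left hP,
      fun x w hx hw i hi => ?_⟩
    have hn := h x w (fun i hi => hx i (by omega)) hw
    rcases Nat.lt_or_ge n i with hlt | hge
    · obtain rfl : i = n + 1 := by omega
      obtain ⟨h1, h2⟩ := hn n le_rfl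
      constructor
      · refine le_max_of_le_right ?_
        rw [hx n (by omega), pow_succ', ← Matrix.mulVec_mulVec, add_sub_right_comm,
          ← Matrix.mulVec_sub]
        exact (norm_add_le _ _).trans
          (add_le_add ((hA _).trans (by gcongr)) (hw n))
      · rw [hx n (by omega)]
        calc ‖A *ᵥ x n + w n‖ ≤ a * (P * ‖x 0‖ + E) + D :=
              (norm_add_le _ _).trans (add_le_add ((hA _).trans (by gcongr)) (hw n))
          _ = a * P * ‖x 0‖ + (a * E + D) := by ring
          _ ≤ _ := by gcongr <;> exact le_max_right _ _
    · obtain ⟨h1, h2⟩ := hn i hge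
      exact ⟨h1.trans (le_max_left _ _), h2.trans (by gcongr <;> exact le_max_left _ _)⟩

/-! ### The coder-controller -/

/-- The data of a coder-controller: a feedback gain `K`, a map `b` that signals the last channel
output through the plant, a blocklength `n`, a feedback code `g` for the messages in `T`, with
decoder `dec`, and a quantizer `quant` of the estimation errors at the beginning of a block with
values `val` at the end of the block. -/
structure ControlScheme (q nx nu : ℕ) (T : Type*) where
  K : Matrix (Fin nu) (Fin nx) ℝ
  b : ZMod q → Fin nu → ℝ
  n : ℕ
  g : ℕ → T → (ℕ → ZMod q) → ZMod q
  dec : (ℕ → ZMod q) → T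
  quant : (Fin nx → ℝ) → T
  val : T → Fin nx → ℝ

namespace ControlScheme

variable {q nx nu : ℕ} {T : Type*} (𝒮 : ControlScheme q nx nu T) (A : Matrix (Fin nx) (Fin nx) ℝ)
  (B : Matrix (Fin nx) (Fin nu) ℝ)

/-- The correction of the state estimate at the end of a block. -/
def correction (t : ℕ) (y : ℕ → ZMod q) : Fin nx → ℝ :=
  if 𝒮.n ∣ t + 1 then 𝒮.val (𝒮.dec fun i => y (t + 1 - 𝒮.n + i)) else 0

/-- The state estimate at time `t`, a function of the channel outputs before `t`. -/
def estimate : ℕ → (ℕ → ZMod q) → Fin nx → ℝ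
  | 0, _ => 0
  | t + 1, y => A *ᵥ estimate t y + B *ᵥ (𝒮.K *ᵥ estimate t y + 𝒮.b (y t)) + 𝒮.correction t y

/-- The output sequence `y` explains the states `x` up to time `t`. -/
def Explains (D : ℝ) (t : ℕ) (x : ℕ → Fin nx → ℝ) (y : ℕ → ZMod q) : Prop :=
  ∀ i < t, ‖x (i + 1) -
    (A *ᵥ x i + B *ᵥ (𝒮.K *ᵥ 𝒮.estimate A B i y + 𝒮.b (y i)))‖ ≤ D

/-- The channel input at time `t`, given the states up to `t` and the outputs before `t`. -/
def input (t : ℕ) (x : ℕ → Fin nx → ℝ) (y : ℕ → ZMod q) : ZMod q :=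
  𝒮.g (t - t / 𝒮.n * 𝒮.n) (𝒮.quant (x (t / 𝒮.n * 𝒮.n) - 𝒮.estimate A B (t / 𝒮.n * 𝒮.n) y))
    (fun i => y (t / 𝒮.n * 𝒮.n + i))

/-- The coder recovers the channel outputs from the plant states; the controller applies the
feedback gain to the state estimate and signals the last channel output. -/
def coderController (D : ℝ) : CoderController q nx nu where
  -- Any explanation of the observed states will do, since by `Explains.eq` its entries before `t`
  -- are forced. The constant extension of `x` past `t` is never read.
  coder t x := 𝒮.input A B t (fun i => x ⟨min i t, by omega⟩)
    (Classical.epsilon (𝒮.Explains A B D t fun i => x ⟨min i t, by omega⟩))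
  controller t y := 𝒮.K *ᵥ 𝒮.estimate A B t (fun i => y ⟨min i t, by omega⟩) +
    𝒮.b (y ⟨t, by omega⟩)

variable {𝒮 A B}

/-- A correction decodes only a completed block, so the estimate is causal in the outputs. -/
theorem estimate_congr
    (hdec : ∀ y y', (∀ i < 𝒮.n, y i = y' i) → 𝒮.dec y = 𝒮.dec y') {t : ℕ}
    {y y' : ℕ → ZMod q} (h : ∀ i < t, y i = y' i) :
    𝒮.estimate A B t y = 𝒮.estimate A B t y' := by
  induction t with
  | zero => rfl
  | succ t ih =>
    have hc : 𝒮.correction t y = 𝒮.correction t y' := by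
      unfold correction
      split_ifs with hd
      · have := Nat.le_of_dvd (by omega) hd
        rw [hdec _ _ fun i hi => h (t + 1 - 𝒮.n + i) (by omega)]
      · rfl
    rw [estimate, estimate, ih fun i hi => h i (by omega), h t (by omega), hc]

/-- Once the earlier outputs agree, so do the estimates. Two candidates for the next output would
then predict states more than `2 * D` apart, both within `D` of the observed one. -/
theorem Explains.eq {D : ℝ}
    (hdec : ∀ y y', (∀ i < 𝒮.n, y i = y' i) → 𝒮.dec y = 𝒮.dec y')
    (hb : ∀ y y', y ≠ y' → 2 * D < ‖B *ᵥ 𝒮.b y - B *ᵥ 𝒮.b y'‖) {t : ℕ} {x : ℕ → Fin nx → ℝ}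
    {y y' : ℕ → ZMod q} (h : 𝒮.Explains A B D t x y) (h' : 𝒮.Explains A B D t x y') :
    ∀ i < t, y i = y' i := by
  intro i
  induction i using Nat.strong_induction_on with
  | _ i ih =>
    intro hi
    by_contra hne
    have h1 := h i hi
    have h2 := h' i hi
    rw [estimate_congr (A := A) (B := B) hdec fun j hj => ih j hj (hj.trans hi)] at h1
    refine absurd (hb _ _ hne) (not_lt.2 ?_)
    have : B *ᵥ 𝒮.b (y i) - B *ᵥ 𝒮.b (y' i) =
        (x (i + 1) - (A *ᵥ x i + B *ᵥ (𝒮.K *ᵥ 𝒮.estimate A B i y' + 𝒮.b (y' i)))) -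
        (x (i + 1) - (A *ᵥ x i + B *ᵥ (𝒮.K *ᵥ 𝒮.estimate A B i y' + 𝒮.b (y i)))) := by
      rw [Matrix.mulVec_add, Matrix.mulVec_add]
      abel
    rw [this]
    linarith [norm_sub_le
      (x (i + 1) - (A *ᵥ x i + B *ᵥ (𝒮.K *ᵥ 𝒮.estimate A B i y' + 𝒮.b (y' i))))
      (x (i + 1) - (A *ᵥ x i + B *ᵥ (𝒮.K *ᵥ 𝒮.estimate A B i y' + 𝒮.b (y i))))]

theorem input_congr
    (hdec : ∀ y y', (∀ i < 𝒮.n, y i = y' i) → 𝒮.dec y = 𝒮.dec y')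
    (hg : ∀ i m y y', (∀ j < i, y j = y' j) → 𝒮.g i m y = 𝒮.g i m y')
    {t : ℕ} {x x' : ℕ → Fin nx → ℝ} {y y' : ℕ → ZMod q} (hx : ∀ i ≤ t, x i = x' i)
    (hy : ∀ i < t, y i = y' i) : 𝒮.input A B t x y = 𝒮.input A B t x' y' := by
  have ht := Nat.div_mul_le_self t 𝒮.n
  rw [input, input, hx _ ht, estimate_congr hdec fun i hi => hy i (by omega)]
  exact hg _ _ _ _ fun j hj => hy _ (by omega)

/-! ### The estimation error in closed loop -/

section Loop

variable {Ω : Type*} {D : ℝ} {V : Ω → ℕ → (Fin nx → ℝ)} {Z : Ω → ℕ → ZMod q}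
  {X : Ω → ℕ → (Fin nx → ℝ)} {Y : Ω → ℕ → ZMod q}
  (hdec : ∀ y y', (∀ i < 𝒮.n, y i = y' i) → 𝒮.dec y = 𝒮.dec y')
  (hloop : IsClosedLoop A B (𝒮.coderController A B D) V Z X Y)

include hdec hloop

theorem plant_eq (π : Ω) (t : ℕ) :
    X π (t + 1) = A *ᵥ X π t +
      B *ᵥ (𝒮.K *ᵥ 𝒮.estimate A B t (Y π) + 𝒮.b (Y π t)) + V π t := by
  rw [hloop.plant]
  simp only [coderController]
  rw [estimate_congr hdec (t := t) (y' := Y π) fun i hi => by rw [min_eq_left hi.le]]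

/-- The outputs read off from the states are the true ones, so the coder acts as if it had a
feedback link. -/
theorem channel_eq (hV : ∀ π t, ‖V π t‖ ≤ D)
    (hg : ∀ i m y y', (∀ j < i, y j = y' j) → 𝒮.g i m y = 𝒮.g i m y')
    (hb : ∀ y y', y ≠ y' → 2 * D < ‖B *ᵥ 𝒮.b y - B *ᵥ 𝒮.b y'‖) (π : Ω) (t : ℕ) :
    Y π t = 𝒮.input A B t (X π) (Y π) + Z π t := by
  rw [hloop.channel]
  congr 1
  simp only [coderController]
  have hex : 𝒮.Explains A B D t (fun i => X π (min i t)) (Y π) := by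
    intro i hi
    simp only
    rw [min_eq_left hi.le, min_eq_left (show i + 1 ≤ t from hi), plant_eq hdec hloop,
      add_sub_cancel_left]
    exact hV π i
  exact input_congr hdec hg (fun i hi => by simp only [min_eq_left hi])
    ((Classical.epsilon_spec (p := 𝒮.Explains A B D t fun i => X π (min i t))
      ⟨_, hex⟩).eq hdec hb hex)

theorem error_succ (π : Ω) (t : ℕ) :
    X π (t + 1) - 𝒮.estimate A B (t + 1) (Y π) =
      A *ᵥ (X π t - 𝒮.estimate A B t (Y π)) + V π t - 𝒮.correction t (Y π) := by
  rw [plant_eq hdec hloop, estimate, Matrix.mulVec_sub]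
  abel

/-- Errors at block starts stay at most `L`: quantization leaves `L / 2` and the noise of the block
adds `E ≤ L / 2`. Within a block the error grows by at most `P`, plus `E`. -/
theorem norm_error_le {σ : Type*} {N : NoiseMachine q σ} (hn : 0 < 𝒮.n)
    (hV : ∀ π t, ‖V π t‖ ≤ D) (hZ : ∀ π, Z π ∈ N.noiseSequences)
    (hg : ∀ i m y y', (∀ j < i, y j = y' j) → 𝒮.g i m y = 𝒮.g i m y')
    (hspec : ∀ y m, N.IsNoiseWindow 𝒮.n (fun i => y i - 𝒮.g i m y) → 𝒮.dec y = m)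
    (hb : ∀ y y', y ≠ y' → 2 * D < ‖B *ᵥ 𝒮.b y - B *ᵥ 𝒮.b y'‖) {E P L : ℝ} (hP : 0 ≤ P)
    (hEP : ∀ x w : ℕ → Fin nx → ℝ,
      (∀ i < 𝒮.n, x (i + 1) = A *ᵥ x i + w i) → (∀ i, ‖w i‖ ≤ D) →
      ∀ i ≤ 𝒮.n, ‖x i - (A ^ i) *ᵥ x 0‖ ≤ E ∧ ‖x i‖ ≤ P * ‖x 0‖ + E)
    (hL : 2 * E ≤ L)
    (hquant : ∀ x, ‖x‖ ≤ L → ‖(A ^ 𝒮.n) *ᵥ x - 𝒮.val (𝒮.quant x)‖ ≤ L / 2)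
    (hinit : ∀ π, ‖X π 0‖ ≤ L) (π : Ω) (t : ℕ) :
    ‖X π t - 𝒮.estimate A B t (Y π)‖ ≤ P * L + E := by
  set e : ℕ → Fin nx → ℝ := fun t => X π t - 𝒮.estimate A B t (Y π) with he
  have hsucc : ∀ t, e (t + 1) = A *ᵥ e t + V π t - 𝒮.correction t (Y π) :=
    error_succ hdec hloop π
  have hcorr : ∀ k, 𝒮.correction (k * 𝒮.n + 𝒮.n - 1) (Y π) = 𝒮.val (𝒮.quant (e (k * 𝒮.n))) := by
    intro k
    have h1 : k * 𝒮.n + 𝒮.n - 1 + 1 = (k + 1) * 𝒮.n := by rw [Nat.succ_mul]; omega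
    have h2 : (k + 1) * 𝒮.n - 𝒮.n = k * 𝒮.n := by rw [Nat.succ_mul]; omega
    rw [correction, h1, if_pos (Dvd.intro_left _ rfl), h2]
    congr 1
    refine hspec _ _ ⟨_, N.shift_mem_noiseSequences (hZ π) (k * 𝒮.n), fun i hi => ?_⟩
    have h3 : (k * 𝒮.n + i) / 𝒮.n * 𝒮.n = k * 𝒮.n := by
      rw [Nat.add_comm, Nat.add_mul_div_right _ _ hn, Nat.div_eq_of_lt hi, zero_add]
    simp only
    rw [channel_eq hdec hloop hV hg hb π (k * 𝒮.n + i), input, h3, Nat.add_sub_cancel_left]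
    simp only [he]
    abel
  -- The correction enters only in the last step of a block. Adding it back at `i = 𝒮.n` gives a
  -- trajectory of the uncorrected recursion, to which `hEP` applies.
  have hblock : ∀ k, ∀ i ≤ 𝒮.n,
      ‖(e (k * 𝒮.n + i) + if i = 𝒮.n then 𝒮.val (𝒮.quant (e (k * 𝒮.n))) else 0) -
        (A ^ i) *ᵥ e (k * 𝒮.n)‖ ≤ E ∧
      ‖e (k * 𝒮.n + i) + if i = 𝒮.n then 𝒮.val (𝒮.quant (e (k * 𝒮.n))) else 0‖ ≤
        P * ‖e (k * 𝒮.n)‖ + E := by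
    intro k i hi
    have := hEP (fun i => e (k * 𝒮.n + i) +
      if i = 𝒮.n then 𝒮.val (𝒮.quant (e (k * 𝒮.n))) else 0) (fun i => V π (k * 𝒮.n + i)) (by
        intro i hi
        simp only [hi.ne, if_false, add_zero]
        rw [← add_assoc, hsucc]
        by_cases hin : i + 1 = 𝒮.n
        · rw [if_pos hin, ← hcorr k, show k * 𝒮.n + 𝒮.n - 1 = k * 𝒮.n + i by omega,
            sub_add_cancel]
        · have : ¬ 𝒮.n ∣ k * 𝒮.n + i + 1 := by
            rw [add_assoc, Nat.dvd_add_right (Dvd.intro_left _ rfl)]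
            intro hd
            have := Nat.le_of_dvd (by omega) hd
            omega
          rw [if_neg hin, correction, if_neg this, sub_zero, add_zero]) (fun i => hV π _) i hi
    simpa only [hn.ne, if_false, add_zero] using this
  have hstart : ∀ k, ‖e (k * 𝒮.n)‖ ≤ L := by
    intro k
    induction k with
    | zero => simpa [he, estimate] using hinit π
    | succ k ih =>
      have h1 := (hblock k 𝒮.n le_rfl).1
      rw [if_pos rfl] at h1
      rw [Nat.succ_mul]
      have h2 : e (k * 𝒮.n + 𝒮.n) =
          (e (k * 𝒮.n + 𝒮.n) + 𝒮.val (𝒮.quant (e (k * 𝒮.n))) - (A ^ 𝒮.n) *ᵥ e (k * 𝒮.n)) +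
          ((A ^ 𝒮.n) *ᵥ e (k * 𝒮.n) - 𝒮.val (𝒮.quant (e (k * 𝒮.n)))) := by abel
      rw [h2]
      refine (norm_add_le _ _).trans ?_
      linarith [hquant _ ih]
  have ht : t / 𝒮.n * 𝒮.n + t % 𝒮.n = t := Nat.div_add_mod' t 𝒮.n
  have hmod := Nat.mod_lt t hn
  have h1 := (hblock (t / 𝒮.n) (t % 𝒮.n) hmod.le).2
  rw [if_neg hmod.ne, add_zero, ht] at h1
  refine h1.trans ?_
  gcongr
  exact hstart _

end Loop

end ControlScheme

/-! ### Choice of the code, the quantizer and the signals -/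

/-- If `B` vanished, feedback could not move the unstable eigenvalue. -/
theorem IsStabilizable.exists_mulVec_ne_zero {n m : ℕ} {A : Matrix (Fin n) (Fin n) ℝ}
    {B : Matrix (Fin n) (Fin m) ℝ} (h : IsStabilizable A B)
    (hA : ∃ μ ∈ complexEigenvalues A, 1 < ‖μ‖) : ∃ u, B *ᵥ u ≠ 0 := by
  by_contra! h0
  obtain ⟨K, hK⟩ := h
  obtain ⟨μ, hμ, h1⟩ := hA
  have hB : B * K = 0 := by
    ext i j
    exact congrFun (h0 fun k => K k j) i
  rw [hB, add_zero] at hK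
  exact absurd (hK μ hμ) (not_lt.2 h1.le)

/-- One direction with nonzero image suffices: the signals are its multiples by the representatives
of `ZMod q`, with step `|r| + 1` after `B`. -/
theorem exists_separated_signals {q n m : ℕ} [NeZero q] {B : Matrix (Fin n) (Fin m) ℝ}
    (hB : ∃ u, B *ᵥ u ≠ 0) (r : ℝ) :
    ∃ b : ZMod q → Fin m → ℝ, ∀ y y', y ≠ y' → r < ‖B *ᵥ b y - B *ᵥ b y'‖ := by
  obtain ⟨u, hu⟩ := hB
  have hu' : 0 < ‖B *ᵥ u‖ := norm_pos_iff.2 hu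
  refine ⟨fun y => ((y.val : ℝ) * ((|r| + 1) / ‖B *ᵥ u‖)) • u, fun y y' hne => ?_⟩
  rw [Matrix.mulVec_smul, Matrix.mulVec_smul, ← sub_smul, ← sub_mul, norm_smul, norm_mul,
    Real.norm_of_nonneg (r := (|r| + 1) / ‖B *ᵥ u‖) (by positivity), mul_assoc,
    div_mul_cancel₀ _ hu'.ne']
  have h1 : (1 : ℝ) ≤ ‖(y.val : ℝ) - (y'.val : ℝ)‖ := by
    have h2 : (y.val : ℤ) - (y'.val : ℤ) ≠ 0 := by
      rw [sub_ne_zero]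
      exact fun h => hne (ZMod.val_injective q (by exact_mod_cast h))
    have h3 := Int.one_le_abs h2
    rw [Real.norm_eq_abs]
    exact_mod_cast h3
  have h2 : (0 : ℝ) < |r| + 1 := by positivity
  nlinarith [le_abs_self r]

/-- If the capacity exceeds the entropy of `A`, there are a blocklength and a feedback code whose
messages quantize the unit ball finely enough. -/
theorem exists_code_and_quantizer {q : ℕ} {σ : Type*} {N : NoiseMachine q σ} {d : ℕ}
    (A : Matrix (Fin d) (Fin d) ℝ) (hC : 0 < N.zeroErrorFeedbackCapacity)
    (hA : linearEntropy A < N.zeroErrorFeedbackCapacity) :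
    ∃ (n : ℕ) (S : Finset (Fin d → ℝ)) (g : ℕ → S → (ℕ → ZMod q) → ZMod q),
      0 < n ∧ N.IsFeedbackCode n g ∧
      ∀ x, ‖x‖ ≤ 1 → ∃ s ∈ S, ‖(A ^ n) *ᵥ (x - s)‖ ≤ 1 / 2 := by
  obtain ⟨h, h1, h2⟩ := exists_between hA
  obtain ⟨n, M, hn, hM, hcode, hrate⟩ := NoiseMachine.exists_hasFeedbackCode_of_lt_capacity hC h2
  -- The covering needs a long block, so the code is repeated; its rate, above `h`, is preserved.
  have htend : Filter.Tendsto (fun j : ℕ => j * n) Filter.atTop Filter.atTop :=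
    Filter.tendsto_id.atTop_mul_const' hn
  obtain ⟨j, ⟨S, hS, hcover⟩, hj⟩ := ((htend.eventually (eventually_exists_covering A h1)).and
    (Filter.eventually_gt_atTop 0)).exists
  have hcard : S.card ≤ M ^ j := by
    have hM' : (0 : ℝ) < M := by exact_mod_cast hM
    have : (S.card : ℝ) ≤ (M : ℝ) ^ j := by
      refine hS.trans ?_
      rw [← Real.le_logb_iff_rpow_le (by norm_num) (by positivity), Real.logb_pow]
      push_cast
      calc (j : ℝ) * n * h = j * (h * n) := by ring
        _ ≤ _ := by gcongr
    exact_mod_cast this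
  obtain ⟨g, hg⟩ := hcode.pow j
  obtain ⟨φ⟩ := Function.Embedding.nonempty_of_card_le
    (show Fintype.card S ≤ Fintype.card (Fin (M ^ j)) by simpa using hcard)
  exact ⟨j * n, S, _, by positivity, hg.comap φ.injective, hcover⟩

theorem exists_coderController {q : ℕ} [NeZero q] {σ : Type*} [Finite σ] [Nonempty σ]
    (N : NoiseMachine q σ) {nx nu : ℕ} (A : Matrix (Fin nx) (Fin nx) ℝ)
    (B : Matrix (Fin nx) (Fin nu) ℝ) (hA : ∃ μ ∈ complexEigenvalues A, 1 < ‖μ‖)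
    (hAB : IsStabilizable A B) (Dx D : ℝ) (hC : 0 < N.zeroErrorFeedbackCapacity)
    (hlt : linearEntropy A + N.entropy < Real.logb 2 q) :
    ∃ c : CoderController q nx nu,
      ∀ (Ω : Type*) (V : Ω → ℕ → (Fin nx → ℝ)) (Z : Ω → ℕ → ZMod q)
        (X : Ω → ℕ → (Fin nx → ℝ)) (Y : Ω → ℕ → ZMod q),
        UncertaintyAssumptions N Dx D (fun π => X π 0) V Z →
        IsClosedLoop A B c V Z X Y →
        UniformlyBounded X := by
  obtain ⟨n, S, g, hn, hg, hcover⟩ := exists_code_and_quantizer A hC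
    (by linarith [NoiseMachine.logb_le_capacity_add_entropy hC])
  obtain ⟨b, hb⟩ := exists_separated_signals (q := q) (hAB.exists_mulVec_ne_zero hA) (2 * D)
  obtain ⟨K, hK⟩ := hAB
  obtain ⟨C, s, hC0, hs0, hs1, hF⟩ := exists_norm_pow_mulVec_le (A + B * K) one_pos hK
  obtain ⟨E, P, hE, hP, hEP⟩ := exists_norm_sub_pow_mulVec_le A D n
  obtain ⟨KB, hKB0, hKB⟩ := exists_norm_map_le (Matrix.toLin' (B * K))
  simp only [Matrix.toLin'_apply] at hKB
  obtain ⟨W, hW⟩ := (Set.finite_range fun y => ‖B *ᵥ b y‖).bddAbove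
  -- Large enough for the initial state and for the noise of one block; the summand 1 makes it
  -- positive, so that the unit-ball cover can be rescaled.
  set L := max Dx (2 * E) + 1 with hL
  have hL0 : 0 < L := by
    have : 0 ≤ max Dx (2 * E) := le_max_of_le_right (by positivity)
    linarith
  -- `Classical.epsilon` needs a nonempty message set.
  obtain ⟨s₀, hs₀, -⟩ := hcover 0 (by simp)
  have : Nonempty S := ⟨⟨s₀, hs₀⟩⟩
  choose! quant hquantS hquant using hcover
  classical
  let 𝒮 : ControlScheme q nx nu S :=
    { K := K
      b := b
      n := n
      g := g
      dec := fun y => Classical.epsilon fun m => N.IsNoiseWindow n fun i => y i - g i m y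
      quant := fun x => Classical.epsilon fun m : S =>
        ‖(A ^ n) *ᵥ x - L • (A ^ n) *ᵥ (m : Fin nx → ℝ)‖ ≤ L / 2
      val := fun m => L • (A ^ n) *ᵥ (m : Fin nx → ℝ) }
  have hdec : ∀ y y', (∀ i < 𝒮.n, y i = y' i) → 𝒮.dec y = 𝒮.dec y' := by
    intro y y' h
    have hi : ∀ m, ∀ i < n, y i - g i m y = y' i - g i m y' := fun m i hi => by
      rw [h i hi, hg.causal i m y y' fun j hj => h j (hj.trans hi)]
    have : (fun m => N.IsNoiseWindow n fun i => y i - g i m y) =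
        fun m => N.IsNoiseWindow n fun i => y' i - g i m y' :=
      funext fun m => propext
        ⟨fun hw => hw.congr fun i h => (hi m i h).symm, fun hw => hw.congr (hi m)⟩
    simp only [𝒮, this]
  have hspec : ∀ y m, N.IsNoiseWindow 𝒮.n (fun i => y i - 𝒮.g i m y) → 𝒮.dec y = m :=
    fun y m h => hg.injective y _ _
      (Classical.epsilon_spec (p := fun m => N.IsNoiseWindow n fun i => y i - g i m y) ⟨m, h⟩) h
  have hq : ∀ x, ‖x‖ ≤ L → ‖(A ^ 𝒮.n) *ᵥ x - 𝒮.val (𝒮.quant x)‖ ≤ L / 2 := by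
    intro x hx
    have hx1 : ‖L⁻¹ • x‖ ≤ 1 := by
      rw [norm_smul, Real.norm_of_nonneg (by positivity), inv_mul_le_one₀ hL0]
      exact hx
    refine Classical.epsilon_spec (p := fun m : S =>
      ‖(A ^ n) *ᵥ x - L • (A ^ n) *ᵥ (m : Fin nx → ℝ)‖ ≤ L / 2)
      ⟨⟨quant (L⁻¹ • x), hquantS _ hx1⟩, ?_⟩
    have h1 : (A ^ n) *ᵥ x - L • (A ^ n) *ᵥ quant (L⁻¹ • x) =
        L • (A ^ n) *ᵥ (L⁻¹ • x - quant (L⁻¹ • x)) := by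
      rw [Matrix.mulVec_sub, Matrix.mulVec_smul, smul_sub, smul_inv_smul₀ hL0.ne']
    simp only [h1]
    rw [norm_smul, Real.norm_of_nonneg hL0.le]
    calc L * _ ≤ L * (1 / 2) := by gcongr; exact hquant _ hx1
      _ = L / 2 := by ring
  refine ⟨𝒮.coderController A B D, fun Ω V Z X Y hU hloop => ?_⟩
  have hZ : ∀ π, Z π ∈ N.noiseSequences := fun π => hU.channel_noise ▸ ⟨π, rfl⟩
  have hinit : ∀ π, ‖X π 0‖ ≤ L := fun π => (hU.init_le π).trans (by
    linarith [le_max_left Dx (2 * E)])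
  have herr := ControlScheme.norm_error_le hdec hloop hn hU.noise_le hZ hg.causal hspec hb hP hEP
    (by linarith [le_max_right Dx (2 * E)]) hq hinit
  refine ⟨C * L + C * (KB * (P * L + E) + W + D) * (1 - s)⁻¹, fun π t => ?_⟩
  -- The state follows the stable matrix `A + B * K`, driven by the estimation error, the signal and
  -- the plant noise, all of them bounded.
  refine (norm_le_of_schur_stable hC0 hs0 hs1 hF (x := X π)
    (w := fun t => -((B * K) *ᵥ (X π t - 𝒮.estimate A B t (Y π))) + B *ᵥ b (Y π t) + V π t)
    (fun t => ?_) (fun t => ?_) t).trans (by gcongr; exact hinit π)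
  · rw [ControlScheme.plant_eq hdec hloop, Matrix.mulVec_add, Matrix.mulVec_mulVec,
      Matrix.add_mulVec, Matrix.mulVec_sub]
    simp only [𝒮]
    abel
  · refine (norm_add₃_le).trans ?_
    rw [norm_neg]
    gcongr
    · exact (hKB _).trans (by gcongr; exact herr π t)
    · exact hW ⟨_, rfl⟩
    · exact hU.noise_le π t

end

theorem corollary2 {q : ℕ} [NeZero q] {σ : Type*} [Finite σ] [Nonempty σ] (N : NoiseMachine q σ)
    {nx nu : ℕ} (A : Matrix (Fin nx) (Fin nx) ℝ) (B : Matrix (Fin nx) (Fin nu) ℝ)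
    (hA : ∃ μ ∈ complexEigenvalues A, 1 < ‖μ‖) (hAB : IsStabilizable A B) (Dx D : ℝ) :
    (0 < N.zeroErrorFeedbackCapacity →
      linearEntropy A + N.entropy < Real.logb 2 q →
      ∃ c : CoderController q nx nu,
        ∀ (Ω : Type*) (V : Ω → ℕ → (Fin nx → ℝ)) (Z : Ω → ℕ → ZMod q)
          (X : Ω → ℕ → (Fin nx → ℝ)) (Y : Ω → ℕ → ZMod q),
          UncertaintyAssumptions N Dx D (fun π => X π 0) V Z →
          IsClosedLoop A B c V Z X Y →
          UniformlyBounded X) ∧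
    (Real.logb 2 q < linearEntropy A + N.entropy →
      ∀ (c : CoderController q nx nu)
        (Ω : Type*) (V : Ω → ℕ → (Fin nx → ℝ)) (Z : Ω → ℕ → ZMod q)
        (X : Ω → ℕ → (Fin nx → ℝ)) (Y : Ω → ℕ → ZMod q),
        UncertaintyAssumptions N Dx D (fun π => X π 0) V Z →
        (∃ l > 0, Metric.closedBall 0 l ⊆ Set.range (fun π => X π 0)) →
        IsClosedLoop A B c V Z X Y →
        ¬ UniformlyBounded X) :=
  ⟨exists_coderController N A B hA hAB Dx D, fun hlt _ _ _ _ _ _ hU hl hloop hb =>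
    absurd (entropy_add_le_of_uniformlyBounded hU hl hloop hb) (not_le.2 hlt)⟩
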